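/- Let $G$ be a finite abelian group, written additively, of order $2^d m$ with $m$ odd, and suppose that its Sylow 2-subgroup is cyclic. Let $\mathcal C\subseteq G$ satisfy $-\mathcal C=\mathcal C$ and $0\notin\mathcal C$, and let $X=X(G,\mathcal C)$ be the Cayley graph with vertex set $G$ in which $g,h$ are adjacent if and only if $h-g\in\mathcal C$. Let $A$ be the adjacency matrix of $X$ and $U(t)=e^{itA}$ for $t\in\mathbb R$. We say that $X$ has perfect state transfer if there are distinct vertices $u\neq v$ and a time $t\in\mathbb R$ such that $|U(t)_{u,v}|=1$. 1. If $d=0$, then $X$ does not have perfect state transfer. 2. If $d=1$, then $X$ has perfect state transfer if and only if $X$ is a perfect matching, that is, every vertex of $X$ has exactly one neighbour. 3. Suppose $d\ge 2$. Then $G$ has a unique element $a$ of order $2$, and exactly two elements $b,-b$ of order $4$. For $k\ge 0$ let $\mathcal C_k$ be the set of elements of $\mathcal C$ whose order is $2^k m'$ with $m'$ odd. For $S\subseteq G$ and $k\in\mathbb N$ put $kS=\{kg: g\in S\}$. Call a subset of $G$ power-closed if it is a union of classes of the equivalence relation $g\approx h\iff\langle g\rangle=\langle h\rangle$ on $G$.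 Then $X$ has perfect state transfer if and only if all of the following hold: (a) $\mathcal C$ is power-closed; (b) exactly one of $a$ and $b$ belongs to $\mathcal C$; (c) $\mathcal C_0=4(\mathcal C_2\setminus\{-b,b\})$; (d) $\mathcal C_1\setminus\{a\}=2(\mathcal C_2\setminus\{-b,b\})$. -/

import Mathlib

/-- The transition matrix `U(t) = exp (i t A)` of the continuous-time quantum walk on the graph `X`,
where `A` is the adjacency matrix of `X`. -/
noncomputable def transitionMatrix {V : Type*} [Fintype V] [DecidableEq V] (X : SimpleGraph V)
    (t : ℝ) : Matrix V V ℂ :=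
  letI : DecidableRel X.Adj := Classical.decRel _
  NormedSpace.exp ((Complex.I * (t : ℂ)) • X.adjMatrix ℂ)

/-- Perfect state transfer from `u` to `v` at time `t`. -/
def HasPSTAt {V : Type*} [Fintype V] [DecidableEq V] (X : SimpleGraph V) (u v : V) (t : ℝ) : Prop :=
  ‖transitionMatrix X t u v‖ = 1

/-- The graph `X` has (admits) perfect state transfer: there is perfect state transfer between
two distinct vertices at some time. (The case `u = v` is periodicity, not state transfer.) -/
def HasPST {V : Type*} [Fintype V] [DecidableEq V] (X : SimpleGraph V) : Prop :=
  ∃ u v : V, u ≠ v ∧ ∃ t : ℝ, HasPSTAt X u v t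

/-- The power class of `g`: all elements that generate the same cyclic subgroup as `g`. -/
def powerClass {G : Type*} [AddGroup G] (g : G) : Set G :=
  {h | AddSubgroup.zmultiples h = AddSubgroup.zmultiples g}

/-- A subset of a group is power-closed if it is a union of power classes. -/
def IsPowerClosed {G : Type*} [AddGroup G] (C : Set G) : Prop :=
  ∃ S : Set G, C = ⋃ g ∈ S, powerClass g

/-- `C_k`: the elements of `C` whose order is `2 ^ k * r` with `r` odd. -/
def twoPart {G : Type*} [AddGroup G] (C : Set G) (k : ℕ) : Set G :=
  {g ∈ C | ∃ r : ℕ, Odd r ∧ addOrderOf g = 2 ^ k * r}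

/-- The set `k S = {k g : g ∈ S}` of `k`-th multiples of the elements of `S` (not a `k`-fold
sumset). -/
def multiples {G : Type*} [AddGroup G] (k : ℕ) (S : Set G) : Set G :=
  {x | ∃ g ∈ S, k • g = x}

/-! ### Characters diagonalise the quantum walk on a Cayley graph. -/

section
open Complex Matrix

/-! The characters of `G` are eigenvectors of `A`, with eigenvalues `λ_χ = charSum C χ`. Hence `|G|
U(t)_{u,v}` is a sum of `|G|` unit complex numbers `exp(itλ_χ) χ(u - v)`, and state transfer means
that they all agree (`hasPST_iff`). Comparing `χ` with `-χ` shows that `c = u - v` has order two,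
which settles odd `|G|`. The eigenvalues sum to zero, which forces them to be rational, hence
integers; Galois conjugation then makes `C` power-closed. What remains is 2-adic
(`HasPST.exists_valuation`): for some `e`, `λ_χ - λ_0` is congruent to `0` or `2^e` modulo `2^(e+1)`
according as `χ c` is `1` or `-1`.

The subgroups of the cyclic Sylow subgroup form a chain. So if `C` is power-closed and `c` has
2-power order, adding `c` to `g` does not affect membership in `C` once the 2-part of `g` lies
outside `⟨c⟩` (`IsOddProjector.add_mem_iff`). A character nontrivial at `c`, summed over the
elements of `C` with given odd part `h`, therefore only sees `h + ⟨c⟩` (`IsOddProjector.sum_fiber`).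
Varying the character on the odd part and inverting the Fourier transform, which is possible modulo
`2^(e+1)`, turns the eigenvalue congruences into congruences for the indicator of `C` on such cosets
(`IsOddProjector.dvd_of_charSum_congr`). At `h = 0` they force `e = 1`. For `h ≠ 0` they are
congruences modulo 4 in a few bits: `h + ⟨a⟩` misses `C` when `d = 1`, and `h + ⟨b⟩` is contained in
`C` or misses it when `d ≥ 2`.

Conversely, for `d ≥ 2` this symmetry makes `C \ ⟨b⟩` invariant under translation by `b`, so it
contributes multiples of 4 to every eigenvalue; the rest of `C` is `{a}` or `{b, -b}` and gives the
right residues for transfer at time `π/2` (`hasPST_of_coset_symmetry`). Since 2 and 4 act invertibly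
on the odd part, (c) and (d) are the same symmetry in other words (`twoPart_eq_iff_coset_symmetry`).
-/

/-- The sum of the character `χ` over the connection set `C`, an eigenvalue of the Cayley graph. -/
noncomputable def charSum {G : Type*} [AddCommGroup G] [Fintype G] (C : Set G)
    (χ : AddChar G ℂ) : ℂ :=
  ∑ g, C.indicator χ g

lemma exp_mulVec_of_mulVec_eq_smul {V : Type*} [Fintype V] [DecidableEq V]
    (M : Matrix V V ℂ) (x : V → ℂ) (l : ℂ) (h : M *ᵥ x = l • x) :
    NormedSpace.exp M *ᵥ x = Complex.exp l • x := by
  let _ : NormedRing (Matrix V V ℂ) := Matrix.linftyOpNormedRing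
  let _ : NormedAlgebra ℂ (Matrix V V ℂ) := Matrix.linftyOpNormedAlgebra
  have hp : ∀ k : ℕ, (M ^ k) *ᵥ x = l ^ k • x := by
    intro k
    induction k with
    | zero => simp
    | succ k ih => rw [pow_succ, ← Matrix.mulVec_mulVec, h, Matrix.mulVec_smul, ih, smul_smul,
        pow_succ, mul_comm]
  have h1 := NormedSpace.exp_series_hasSum_exp' (𝕂 := ℂ) M
  have h2 := h1.map (Matrix.mulVec.addMonoidHomLeft x) (by
    change Continuous fun A : Matrix V V ℂ => A *ᵥ x
    fun_prop)
  have h3 := (NormedSpace.exp_series_hasSum_exp' (𝕂 := ℂ) l).smul_const x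
  rw [Complex.exp_eq_exp_ℂ]
  refine h2.unique ?_
  convert h3 using 2 with k
  change ((k.factorial : ℂ)⁻¹ • M ^ k) *ᵥ x = _
  rw [Matrix.smul_mulVec, hp, smul_assoc]

/-- Equality case of the triangle inequality: with `S` the sum, each `Re (conj S * z i)` is at most
`n` and together they reach `n²`, so every `conj S * z i` equals `n`. -/
lemma eq_of_norm_sum_eq_card {ι : Type*} [Fintype ι] (z : ι → ℂ) (hz : ∀ i, ‖z i‖ = 1)
    (h : ‖∑ i, z i‖ = Fintype.card ι) (i j : ι) : z i = z j := by
  set S := ∑ i, z i with hS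
  have hn : (0 : ℝ) < Fintype.card ι := by
    exact_mod_cast Fintype.card_pos_iff.2 ⟨i⟩
  have key : ∀ i, (starRingEnd ℂ S * z i).re = Fintype.card ι := by
    have hle : ∀ i ∈ Finset.univ, (starRingEnd ℂ S * z i).re ≤ Fintype.card ι := fun i _ => by
      refine (Complex.re_le_norm _).trans ?_
      rw [norm_mul, hz, mul_one, RCLike.norm_conj, h]
    have hsum : ∑ i, (starRingEnd ℂ S * z i).re = ∑ i : ι, (Fintype.card ι : ℝ) := by
      rw [← Complex.re_sum, ← Finset.mul_sum, ← hS, mul_comm, Complex.mul_conj, Complex.ofReal_re,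
        Complex.normSq_eq_norm_sq, h]
      simp [pow_two]
    intro i
    exact (Finset.sum_eq_sum_iff_of_le hle).1 hsum i (Finset.mem_univ i)
  have key2 : ∀ i, starRingEnd ℂ S * z i = Fintype.card ι := by
    intro i
    have hnorm : ‖starRingEnd ℂ S * z i‖ = Fintype.card ι := by
      rw [norm_mul, hz, mul_one, RCLike.norm_conj, h]
    apply Complex.ext
    · rw [key i]; simp
    · have := Complex.sq_norm (starRingEnd ℂ S * z i)
      rw [Complex.normSq_apply, hnorm, key i] at this
      have h0 : (starRingEnd ℂ S * z i).im = 0 := by nlinarith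
      rw [h0]; simp
  have hS0 : starRingEnd ℂ S ≠ 0 := by
    rw [← norm_ne_zero_iff, RCLike.norm_conj, h]; exact hn.ne'
  exact mul_left_cancel₀ hS0 ((key2 i).trans (key2 j).symm)

section
variable {G : Type*} [AddCommGroup G] [Fintype G]

lemma charSum_conj (C : Set G) (hneg : ∀ g ∈ C, -g ∈ C) (χ : AddChar G ℂ) :
    starRingEnd ℂ (charSum C χ) = charSum C χ := by
  classical
  have hiff : ∀ g, -g ∈ C ↔ g ∈ C := fun g => ⟨fun h => by simpa using hneg _ h, hneg g⟩
  rw [charSum, map_sum]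
  refine Fintype.sum_equiv (Equiv.neg G) _ _ fun g => ?_
  simp only [Set.indicator_apply, Equiv.neg_apply, hiff]
  split_ifs
  · rw [AddChar.map_neg_eq_conj]
  · simp

lemma charSum_neg (C : Set G) (hneg : ∀ g ∈ C, -g ∈ C) (χ : AddChar G ℂ) :
    charSum C (-χ) = charSum C χ := by
  classical
  have hiff : ∀ g, -g ∈ C ↔ g ∈ C := fun g => ⟨fun h => by simpa using hneg _ h, hneg g⟩
  refine Fintype.sum_equiv (Equiv.neg G) _ _ fun g => ?_
  simp only [Set.indicator_apply, Equiv.neg_apply, hiff, AddChar.neg_apply]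

lemma norm_exp_charSum (C : Set G) (hneg : ∀ g ∈ C, -g ∈ C) (χ : AddChar G ℂ) (t : ℝ) :
    ‖exp (I * t * charSum C χ)‖ = 1 := by
  have := Complex.conj_eq_iff_real.1 (charSum_conj C hneg χ)
  obtain ⟨r, hr⟩ := this
  rw [hr, mul_assoc, mul_comm, ← Complex.ofReal_mul, Complex.norm_exp_ofReal_mul_I]

omit [Fintype G] in
lemma addCayley_adj_iff (C : Set G) (hneg : ∀ g ∈ C, -g ∈ C) (hzero : (0 : G) ∉ C) (u v : G) :
    (SimpleGraph.addCayley C).Adj u v ↔ v - u ∈ C := by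
  rw [SimpleGraph.addCayley_adj']
  constructor
  · rintro ⟨-, g, hg, rfl | rfl⟩
    · simpa using hg
    · simpa using hneg g hg
  · intro h
    refine ⟨fun e => hzero ?_, v - u, h, Or.inl (by abel)⟩
    simpa [e] using h

variable [DecidableEq G]

/-- Expanding `U(t) χ = exp(itλ_χ) χ` at `u` and summing over `χ` isolates the entry at `v` by
orthogonality of characters. -/
lemma card_mul_transitionMatrix (C : Set G) (hneg : ∀ g ∈ C, -g ∈ C) (hzero : (0 : G) ∉ C)
    (t : ℝ) (u v : G) :
    Fintype.card G * transitionMatrix (SimpleGraph.addCayley C) t u v =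
      ∑ χ : AddChar G ℂ, exp (I * t * charSum C χ) * χ (u - v) := by
  classical
  have hχ : ∀ χ : AddChar G ℂ, transitionMatrix (SimpleGraph.addCayley C) t *ᵥ χ =
      exp (I * t * charSum C χ) • (χ : G → ℂ) := by
    intro χ
    refine exp_mulVec_of_mulVec_eq_smul _ _ _ ?_
    rw [Matrix.smul_mulVec, mul_smul (I * t)]
    congr 1
    ext g
    rw [Matrix.mulVec, dotProduct, Pi.smul_apply, smul_eq_mul, charSum, Finset.sum_mul]
    refine Fintype.sum_equiv (Equiv.subRight g) _ _ fun w => ?_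
    simp only [SimpleGraph.adjMatrix_apply, addCayley_adj_iff C hneg hzero, Equiv.subRight_apply,
      Set.indicator_apply]
    split_ifs
    · rw [one_mul, ← AddChar.map_add_eq_mul, sub_add_cancel]
    · simp
  have h1 : ∀ χ : AddChar G ℂ, exp (I * t * charSum C χ) * χ (u - v) =
      ∑ w, transitionMatrix (SimpleGraph.addCayley C) t u w * χ (w - v) := by
    intro χ
    have := congrFun (hχ χ) u
    rw [Matrix.mulVec, dotProduct, Pi.smul_apply, smul_eq_mul] at this
    simp_rw [sub_eq_add_neg, AddChar.map_add_eq_mul, ← mul_assoc]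
    rw [← this, Finset.sum_mul]
  simp_rw [h1]
  rw [Finset.sum_comm]
  simp_rw [← Finset.mul_sum, AddChar.sum_apply_eq_ite, sub_eq_zero]
  simp [mul_comm]

lemma hasPSTAt_iff (C : Set G) (hneg : ∀ g ∈ C, -g ∈ C) (hzero : (0 : G) ∉ C)
    (t : ℝ) (u v : G) :
    HasPSTAt (SimpleGraph.addCayley C) u v t ↔ ∀ χ : AddChar G ℂ,
      exp (I * t * charSum C χ) * χ (u - v) = exp (I * t * charSum C 0) := by
  have hcard : (0 : ℝ) < Fintype.card G := by exact_mod_cast Fintype.card_pos_iff.2 ⟨0⟩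
  have hmain := card_mul_transitionMatrix C hneg hzero t u v
  have hn : ‖∑ χ : AddChar G ℂ, exp (I * t * charSum C χ) * χ (u - v)‖ =
      Fintype.card G * ‖transitionMatrix (SimpleGraph.addCayley C) t u v‖ := by
    rw [← hmain, norm_mul]; simp
  rw [HasPSTAt]
  constructor
  · intro h χ
    rw [h, mul_one, ← AddChar.card_eq (α := G)] at hn
    have := eq_of_norm_sum_eq_card _ (fun χ => by
      rw [norm_mul, norm_exp_charSum C hneg, AddChar.norm_apply, one_mul]) hn χ 0
    simpa using this
  · intro h
    simp_rw [h] at hn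
    rw [Finset.sum_const, nsmul_eq_mul, norm_mul, norm_exp_charSum C hneg, Finset.card_univ,
      AddChar.card_eq, mul_one, Complex.norm_natCast] at hn
    exact (mul_left_cancel₀ hcard.ne' (by rw [← hn, mul_one])).symm

lemma hasPST_iff (C : Set G) (hneg : ∀ g ∈ C, -g ∈ C) (hzero : (0 : G) ∉ C) :
    HasPST (SimpleGraph.addCayley C) ↔ ∃ c : G, c ≠ 0 ∧ ∃ t : ℝ, ∀ χ : AddChar G ℂ,
      exp (I * t * charSum C χ) * χ c = exp (I * t * charSum C 0) := by
  simp only [HasPST, hasPSTAt_iff C hneg hzero]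
  constructor
  · rintro ⟨u, v, huv, t, h⟩
    exact ⟨u - v, sub_ne_zero.2 huv, t, h⟩
  · rintro ⟨c, hc, t, h⟩
    exact ⟨c, 0, hc, t, by simpa using h⟩

end

end

/-! ### Integral spectrum and power-closed connection sets. -/

section
open Polynomial

lemma IsIntegral.exists_int_of_ratCast {q : ℚ} (h : IsIntegral ℤ (q : ℂ)) : ∃ z : ℤ, q = z := by
  have h1 : IsIntegral ℤ q := by
    refine (isIntegral_algHom_iff (Algebra.algHom ℤ ℚ ℂ) ?_).1 (by simpa using h)
    exact (algebraMap ℚ ℂ).injective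
  obtain ⟨z, hz⟩ := IsIntegrallyClosed.isIntegral_iff.1 h1
  exact ⟨z, by simpa using hz.symm⟩

lemma Int.dvd_of_mul_isIntegral {q z : ℤ} {x : ℂ} (hx : IsIntegral ℤ x) (h : (z : ℂ) = q * x) :
    q ∣ z := by
  by_cases hq : q = 0
  · subst hq
    simp at h
    simp [h]
  have hq' : (q : ℂ) ≠ 0 := by exact_mod_cast hq
  have hx' : x = ((z / q : ℚ) : ℂ) := by
    push_cast
    field_simp
    rw [h]; ring
  rw [hx'] at hx
  obtain ⟨w, hw⟩ := hx.exists_int_of_ratCast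
  have hq2 : (q : ℚ) ≠ 0 := by exact_mod_cast hq
  refine ⟨w, ?_⟩
  rw [div_eq_iff hq2] at hw
  have : (z : ℚ) = (q * w : ℤ) := by rw [hw]; push_cast; ring
  exact_mod_cast this

lemma IsPrimitiveRoot.aeval_pow_eq_zero {ζ : ℂ} {n k : ℕ} (hn : 0 < n) (hζ : IsPrimitiveRoot ζ n)
    (hk : k.Coprime n) {p : ℤ[X]} (hp : aeval ζ p = 0) : aeval (ζ ^ k) p = 0 := by
  have h1 := minpoly.isIntegrallyClosed_dvd (hζ.isIntegral hn) hp
  rw [hζ.minpoly_eq_pow_coprime hk] at h1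
  obtain ⟨r, hr⟩ := h1
  rw [hr, map_mul, minpoly.aeval, zero_mul]

section
variable {G : Type*} [AddCommGroup G] [Fintype G]

lemma AddChar.pow_card_eq_one' (χ : AddChar G ℂ) (g : G) : χ g ^ Fintype.card G = 1 := by
  rw [← AddChar.map_nsmul_eq_pow, card_nsmul_eq_zero, AddChar.map_zero_eq_one]

lemma AddChar.isIntegral_apply (χ : AddChar G ℂ) (g : G) : IsIntegral ℤ (χ g) :=
  IsIntegral.of_pow Fintype.card_pos (by rw [χ.pow_card_eq_one']; exact isIntegral_one)

lemma isIntegral_charSum (C : Set G) (χ : AddChar G ℂ) : IsIntegral ℤ (charSum C χ) := by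
  classical
  refine IsIntegral.sum _ fun g _ => ?_
  rw [Set.indicator_apply]
  split_ifs
  exacts [χ.isIntegral_apply g, isIntegral_zero]

lemma AddChar.exists_exponents {K : Type*} [Field K] {ζ : K}
    (hζ : IsPrimitiveRoot ζ (Fintype.card G))
    (χ : AddChar G K) : ∃ e : G → ℕ, ∀ g, χ g = ζ ^ e g := by
  have : ∀ g, ∃ i : ℕ, χ g = ζ ^ i := fun g => by
    have h : χ g ^ Fintype.card G = 1 := by
      rw [← AddChar.map_nsmul_eq_pow, card_nsmul_eq_zero, AddChar.map_zero_eq_one]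
    obtain ⟨i, -, hi⟩ := hζ.eq_pow_of_pow_eq_one h
    exact ⟨i, hi.symm⟩
  exact ⟨fun g => (this g).choose, fun g => (this g).choose_spec⟩

/-- The equation `charSum C χ = z` is an integer polynomial relation in a root of unity `ζ`. It
persists under the conjugation `ζ ↦ ζ ^ k`, which replaces `χ` by `k • χ`. -/
lemma charSum_nsmul_eq_of_int (C : Set G) (χ : AddChar G ℂ) {z : ℤ} (hz : charSum C χ = z)
    {k : ℕ} (hk : k.Coprime (Fintype.card G)) : charSum C (k • χ) = charSum C χ := by
  classical
  have hζ := Complex.isPrimitiveRoot_exp (Fintype.card G) Fintype.card_ne_zero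
  obtain ⟨e, he⟩ := χ.exists_exponents hζ
  set ζ := Complex.exp (2 * Real.pi * Complex.I / (Fintype.card G : ℕ))
  let p : ℤ[X] := ∑ g, (if g ∈ C then X ^ e g else 0) - Polynomial.C z
  have hp : ∀ x : ℂ, aeval x p = ∑ g, (if g ∈ C then x ^ e g else 0) - z := by
    intro x
    simp only [p, map_sub, map_sum, apply_ite (aeval x), map_zero, map_pow, aeval_X, aeval_C]
    simp
  have h0 : aeval ζ p = 0 := by
    rw [hp, ← hz, charSum]
    simp [Set.indicator_apply, he]
  have h1 := hζ.aeval_pow_eq_zero Fintype.card_pos hk h0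
  rw [hp, sub_eq_zero, ← hz] at h1
  rw [← h1, charSum]
  refine Finset.sum_congr rfl fun g _ => ?_
  rw [Set.indicator_apply, AddChar.nsmul_apply, he]
  simp [← pow_mul, mul_comm]

lemma sum_charSum_mul_neg (C : Set G) (g : G) :
    ∑ χ : AddChar G ℂ, charSum C χ * χ (-g) = Fintype.card G * C.indicator 1 g := by
  classical
  simp only [charSum, Finset.sum_mul]
  rw [Finset.sum_comm]
  have : ∀ x, ∑ χ : AddChar G ℂ, C.indicator χ x * χ (-g) =
      C.indicator 1 x * ∑ χ : AddChar G ℂ, χ (x - g) := by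
    intro x
    rw [Finset.mul_sum]
    refine Finset.sum_congr rfl fun χ _ => ?_
    by_cases hx : x ∈ C <;> simp [hx, sub_eq_add_neg, AddChar.map_add_eq_mul]
  simp_rw [this, AddChar.sum_apply_eq_ite, sub_eq_zero]
  simp [mul_comm]

lemma eq_of_charSum_eq {C D : Set G} (h : ∀ χ, charSum C χ = charSum D χ) : C = D := by
  classical
  ext g
  have h1 := sum_charSum_mul_neg C g
  simp_rw [h, sum_charSum_mul_neg] at h1
  have h2 : (Fintype.card G : ℂ) ≠ 0 := by exact_mod_cast Fintype.card_ne_zero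
  have h3 := mul_left_cancel₀ h2 h1
  by_cases hC : g ∈ C <;> by_cases hD : g ∈ D <;> simp_all

/-- The set `k C` has the same character sums as `C`, so Fourier inversion identifies the two. -/
lemma nsmul_mem_of_charSum_int {C : Set G} (h : ∀ χ, ∃ z : ℤ, charSum C χ = z)
    {k : ℕ} (hk : k.Coprime (Fintype.card G)) {g : G} (hg : g ∈ C) : k • g ∈ C := by
  classical
  have hk' : (Nat.card G).Coprime k := by rw [Nat.card_eq_fintype_card]; exact hk.symm
  let σ := nsmulCoprime hk'
  have hσ : σ.symm ⁻¹' C = C := eq_of_charSum_eq fun χ => by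
    obtain ⟨z, hz⟩ := h χ
    rw [← charSum_nsmul_eq_of_int C χ hz hk]
    symm
    refine Fintype.sum_equiv σ _ _ fun x => ?_
    simp only [Set.indicator_apply, Set.mem_preimage, Equiv.symm_apply_apply]
    congr 1
    rw [AddChar.nsmul_apply, ← AddChar.map_nsmul_eq_pow]
    rfl
  rw [← hσ]
  change σ.symm (σ g) ∈ C
  simpa using hg

omit [Fintype G] in
lemma isPowerClosed_iff {C : Set G} : IsPowerClosed C ↔
    ∀ g h, AddSubgroup.zmultiples h = AddSubgroup.zmultiples g → g ∈ C → h ∈ C := by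
  constructor
  · rintro ⟨S, rfl⟩ g h hgh hg
    simp only [Set.mem_iUnion, powerClass, Set.mem_ofPred_eq, exists_prop] at hg ⊢
    obtain ⟨s, hs, hgs⟩ := hg
    exact ⟨s, hs, hgh.trans hgs⟩
  · intro H
    refine ⟨C, Set.Subset.antisymm (fun g hg => ?_) ?_⟩
    · simp only [Set.mem_iUnion, powerClass, Set.mem_ofPred_eq, exists_prop]
      exact ⟨g, hg, rfl⟩
    · intro h hh
      simp only [Set.mem_iUnion, powerClass, Set.mem_ofPred_eq, exists_prop] at hh
      obtain ⟨g, hg, hgh⟩ := hh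
      exact H g h hgh hg

lemma zmultiples_zsmul_of_isCoprime {k : ℤ} (hk : IsCoprime k (Fintype.card G : ℤ)) (g : G) :
    AddSubgroup.zmultiples (k • g) = AddSubgroup.zmultiples g := by
  apply le_antisymm
  · rw [AddSubgroup.zmultiples_le]
    exact ⟨k, rfl⟩
  · rw [AddSubgroup.zmultiples_le]
    obtain ⟨u, v, h⟩ := hk
    refine ⟨u, ?_⟩
    have : (v * (Fintype.card G : ℤ)) • g = 0 := by
      rw [mul_smul, natCast_zsmul, card_nsmul_eq_zero, smul_zero]
    change u • k • g = g
    rw [← mul_smul, ← add_zero ((u * k) • g), ← this, ← add_smul, h, one_smul]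

lemma IsPowerClosed.zsmul_mem_iff {C : Set G} (hC : IsPowerClosed C) {k : ℤ}
    (hk : IsCoprime k (Fintype.card G : ℤ)) (g : G) : k • g ∈ C ↔ g ∈ C := by
  rw [isPowerClosed_iff] at hC
  exact ⟨hC _ _ (zmultiples_zsmul_of_isCoprime hk g).symm, hC _ _ (zmultiples_zsmul_of_isCoprime hk g)⟩

/-- The multiplier is at first coprime only to the order of `g`; units modulo a divisor lift to
units modulo `|G|`. -/
lemma exists_coprime_nsmul_of_zmultiples_eq {g h : G}
    (hgh : AddSubgroup.zmultiples h = AddSubgroup.zmultiples g) :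
    ∃ k : ℕ, k.Coprime (Fintype.card G) ∧ h = k • g := by
  classical
  have hh : h ∈ AddSubgroup.zmultiples g := hgh ▸ AddSubgroup.mem_zmultiples h
  obtain ⟨j, hj⟩ := mem_zmultiples_iff_mem_range_addOrderOf.1 hh |> Finset.mem_image.1
  obtain ⟨-, hj⟩ := hj
  have hord : addOrderOf h = addOrderOf g := by
    rw [← Nat.card_zmultiples, hgh, Nat.card_zmultiples]
  have hpos := addOrderOf_pos g
  have hcop : j.Coprime (addOrderOf g) := by
    rw [← hj, addOrderOf_nsmul] at hord
    have hd := Nat.gcd_dvd_left (addOrderOf g) j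
    have := Nat.div_mul_cancel hd
    rw [hord] at this
    have h1 : (addOrderOf g).gcd j = 1 := by
      exact Nat.eq_of_mul_eq_mul_left hpos (by rw [this, mul_one])
    exact (Nat.coprime_comm.1 h1)
  have hdvd : addOrderOf g ∣ Fintype.card G := addOrderOf_dvd_card
  have : NeZero (Fintype.card G) := ⟨Fintype.card_ne_zero⟩
  obtain ⟨u, hu⟩ := ZMod.unitsMap_surjective hdvd (ZMod.unitOfCoprime j hcop)
  refine ⟨(u : ZMod (Fintype.card G)).val, ZMod.val_coe_unit_coprime u, ?_⟩
  rw [← hj]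
  have h2 := congrArg (fun w : (ZMod (addOrderOf g))ˣ => (w : ZMod (addOrderOf g))) hu
  simp only [ZMod.unitsMap_def, Units.coe_map, ZMod.coe_unitOfCoprime] at h2
  have h3 : (((u : ZMod (Fintype.card G)).val : ℕ) : ZMod (addOrderOf g)) = (j : ℕ) := by
    rw [← h2]
    simp [ZMod.castHom_apply, ZMod.natCast_val]
  rw [ZMod.natCast_eq_natCast_iff] at h3
  exact (nsmul_eq_nsmul_iff_modEq.2 h3.symm)

lemma isPowerClosed_of_charSum_int {C : Set G} (h : ∀ χ, ∃ z : ℤ, charSum C χ = z) :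
    IsPowerClosed C := by
  rw [isPowerClosed_iff]
  intro g x hgx hg
  obtain ⟨k, hk, rfl⟩ := exists_coprime_nsmul_of_zmultiples_eq hgx
  exact nsmul_mem_of_charSum_int h hk hg

/-- A Galois automorphism of the cyclotomic field raises roots of unity to a power coprime to `|G|`,
which merely permutes `C`. The sum is thus fixed, hence rational, and it is an algebraic integer. -/
lemma IsPowerClosed.charSum_int {C : Set G} (hC : IsPowerClosed C) (χ : AddChar G ℂ) :
    ∃ z : ℤ, charSum C χ = z := by
  classical
  suffices ∃ q : ℚ, charSum C χ = q by
    obtain ⟨q, hq⟩ := this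
    have := isIntegral_charSum C χ
    rw [hq] at this
    obtain ⟨z, hz⟩ := this.exists_int_of_ratCast
    exact ⟨z, by rw [hq, hz]; simp⟩
  set n := Fintype.card G
  have : NeZero n := ⟨Fintype.card_ne_zero⟩
  have : NeZero (n : ℚ) := ⟨Nat.cast_ne_zero.2 Fintype.card_ne_zero⟩
  let K := CyclotomicField n ℚ
  have : IsCyclotomicExtension {n} ℚ K := CyclotomicField.isCyclotomicExtension n ℚ
  have hgal : IsGalois ℚ K := IsCyclotomicExtension.isGalois {n} ℚ K
  have hfin : FiniteDimensional ℚ K := IsCyclotomicExtension.finiteDimensional {n} ℚ K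
  have hζ : IsPrimitiveRoot (IsCyclotomicExtension.zeta n ℚ K) n :=
    IsCyclotomicExtension.zeta_spec n ℚ K
  set ζ := IsCyclotomicExtension.zeta n ℚ K
  let ι : K →ₐ[ℚ] ℂ := IsAlgClosed.lift
  have hζ' : IsPrimitiveRoot (ι ζ) n := hζ.map_of_injective ι.injective
  obtain ⟨e, he⟩ := χ.exists_exponents hζ'
  let x : K := ∑ g, if g ∈ C then ζ ^ e g else 0
  have hx : ι x = charSum C χ := by
    simp only [x, map_sum, charSum, apply_ite ι, map_zero, map_pow, Set.indicator_apply, he]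
  suffices x ∈ Set.range (algebraMap ℚ K) by
    obtain ⟨q, hq⟩ := this
    exact ⟨q, by rw [← hx, ← hq]; simp⟩
  rw [IsGalois.mem_range_algebraMap_iff_fixed]
  intro σ
  have hσ : IsPrimitiveRoot (σ ζ) n := hζ.map_of_injective σ.injective
  obtain ⟨k, -, hk, hσk⟩ := (hζ.isPrimitiveRoot_iff).1 hσ
  apply ι.injective
  change ι (σ x) = ι x
  have hk' : (Nat.card G).Coprime k := by rw [Nat.card_eq_fintype_card]; exact hk.symm
  rw [hx]
  simp only [x, map_sum, apply_ite σ, apply_ite ι, map_zero, map_pow, ← hσk]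
  refine Fintype.sum_equiv (nsmulCoprime hk') _ _ fun g => ?_
  have hmem : k • g ∈ C ↔ g ∈ C := by
    rw [← natCast_zsmul]
    exact hC.zsmul_mem_iff (Nat.isCoprime_iff_coprime.2 hk) g
  change _ = C.indicator χ (k • g)
  rw [Set.indicator_apply]
  simp only [hmem]
  split_ifs
  · rw [AddChar.map_nsmul_eq_pow, he, ← pow_mul, ← pow_mul, mul_comm]
  · rfl

end

end

/-! ### From phases to 2-adic congruences of eigenvalues, and back. -/

section
open Complex

section
variable {G : Type*} [AddCommGroup G] [Fintype G]

omit [Fintype G] in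
lemma AddChar.apply_eq_one_or_neg_one {χ : AddChar G ℂ} {c : G} (hc : 2 • c = 0) :
    χ c = 1 ∨ χ c = -1 := by
  rw [← sq_eq_one_iff, ← AddChar.map_nsmul_eq_pow, hc, AddChar.map_zero_eq_one]

lemma Complex.exists_int_of_exp_I_mul {x : ℝ} {w : ℂ} (hw : w = 1 ∨ w = -1)
    (h : exp (I * x) = w) :
    ∃ N : ℤ, x = Real.pi * N ∧ (w = 1 → Even N) ∧ (w = -1 → Odd N) := by
  rcases hw with rfl | rfl
  · obtain ⟨n, hn⟩ := Complex.exp_eq_one_iff.1 h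
    refine ⟨2 * n, ?_, fun _ => even_two_mul n, fun h => by norm_num at h⟩
    have : (x : ℂ) = (Real.pi * (2 * n : ℤ) : ℝ) := by
      apply mul_left_cancel₀ I_ne_zero
      rw [hn]; push_cast; ring
    exact_mod_cast this
  · rw [← Complex.exp_pi_mul_I, Complex.exp_eq_exp_iff_exists_int] at h
    obtain ⟨n, hn⟩ := h
    refine ⟨2 * n + 1, ?_, fun h => by norm_num at h, fun _ => odd_two_mul_add_one n⟩
    have : (x : ℂ) = (Real.pi * (2 * n + 1 : ℤ) : ℝ) := by
      apply mul_left_cancel₀ I_ne_zero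
      rw [hn]; push_cast; ring
    exact_mod_cast this

lemma charSum_zero (C : Set G) : charSum C 0 = (C.ncard : ℂ) := by
  classical
  have : ∀ g, C.indicator (⇑(0 : AddChar G ℂ)) g = if g ∈ C then 1 else 0 := fun g => by
    simp [Set.indicator_apply]
  simp_rw [charSum, this]
  rw [Finset.sum_boole, Set.ncard_eq_toFinset_card']
  congr 2
  ext; simp

lemma sum_charSum (C : Set G) (hzero : (0 : G) ∉ C) : ∑ χ, charSum C χ = 0 := by
  have := sum_charSum_mul_neg C 0
  simpa [hzero] using this

lemma two_nsmul_eq_zero_of_phases {C : Set G} (hneg : ∀ g ∈ C, -g ∈ C) {c : G} {t : ℝ}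
    (h : ∀ χ : AddChar G ℂ, exp (I * t * charSum C χ) * χ c = exp (I * t * charSum C 0)) :
    2 • c = 0 := by
  rw [← AddChar.forall_apply_eq_zero]
  intro χ
  have h1 := h χ
  have h2 := h (-χ)
  rw [charSum_neg C hneg, ← h1, AddChar.neg_apply'] at h2
  have h3 := mul_left_cancel₀ (Complex.exp_ne_zero _) h2
  rw [AddChar.map_nsmul_eq_pow, sq]
  nth_rewrite 1 [← h3]
  exact inv_mul_cancel₀ (χ.val_isUnit c).ne_zero

lemma exists_int_phases {C : Set G} {c : G} {t : ℝ} (hc2 : 2 • c = 0)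
    {r : AddChar G ℂ → ℝ} (hr : ∀ χ, charSum C χ = r χ)
    (h : ∀ χ : AddChar G ℂ, exp (I * t * charSum C χ) * χ c = exp (I * t * charSum C 0)) :
    ∃ N : AddChar G ℂ → ℤ, ∀ χ, t * (r χ - r 0) = Real.pi * N χ ∧
      (χ c = 1 → Even (N χ)) ∧ (χ c = -1 → Odd (N χ)) := by
  suffices ∀ χ : AddChar G ℂ, exp (I * ((t * (r χ - r 0) : ℝ) : ℂ)) = χ c by
    choose N hN using fun χ => Complex.exists_int_of_exp_I_mul
      (AddChar.apply_eq_one_or_neg_one hc2) (this χ)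
    exact ⟨N, hN⟩
  intro χ
  have h1 := h χ
  rw [hr, hr] at h1
  have h2 : I * ((t * (r χ - r 0) : ℝ) : ℂ) = I * t * r χ - I * t * r 0 := by push_cast; ring
  rw [h2, Complex.exp_sub, ← h1]
  have hs : χ c * χ c = 1 := by
    rw [← AddChar.map_add_eq_mul, ← two_nsmul, hc2, AddChar.map_zero_eq_one]
  have h0 := (χ.val_isUnit c).ne_zero
  have h3 := Complex.exp_ne_zero (I * t * r χ)
  field_simp
  rw [sq, hs]

/-- Summing the phase equations over all `χ` and using that `A` has trace zero gives `-t |G| |C| = π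
∑ N χ`. This eliminates `t / π`, so the eigenvalues are rational. -/
lemma charSum_int_of_phases {C : Set G} (hzero : (0 : G) ∉ C) {t : ℝ}
    {r : AddChar G ℂ → ℝ} (hr : ∀ χ, charSum C χ = r χ) {N : AddChar G ℂ → ℤ}
    (hN : ∀ χ, t * (r χ - r 0) = Real.pi * N χ) {χ₁ : AddChar G ℂ} (h1 : N χ₁ ≠ 0)
    (χ : AddChar G ℂ) : ∃ z : ℤ, charSum C χ = z := by
  have hr0 : r 0 = C.ncard := by
    have := (hr 0).symm.trans (charSum_zero C)
    exact_mod_cast this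
  have hpi := Real.pi_ne_zero
  have hNR : (N χ₁ : ℝ) ≠ 0 := by exact_mod_cast h1
  have ht : t ≠ 0 := by
    rintro rfl
    have := hN χ₁
    rw [zero_mul] at this
    exact mul_ne_zero hpi hNR this.symm
  have hC : (C.ncard : ℝ) ≠ 0 := by
    intro h0
    have h0' : C.ncard = 0 := by exact_mod_cast h0
    rw [Set.ncard_eq_zero] at h0'
    subst h0'
    have hall : ∀ χ, r χ = 0 := fun χ => by
      have := hr χ
      simp [charSum] at this
      exact_mod_cast this.symm
    have := hN χ₁
    rw [hall, hall] at this
    simp [hpi, h1] at this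
  have hsum : ∑ χ, r χ = 0 := by
    have := sum_charSum C hzero
    simp_rw [hr] at this
    exact_mod_cast this
  have hS : t * (-(Fintype.card G * C.ncard)) = Real.pi * (∑ χ, N χ : ℤ) := by
    push_cast
    rw [Finset.mul_sum]
    simp_rw [← hN]
    rw [← Finset.mul_sum, Finset.sum_sub_distrib, hsum, Finset.sum_const, Finset.card_univ,
      AddChar.card_eq, hr0, nsmul_eq_mul, zero_sub]
  set S := ∑ χ, N χ
  have hcard : (Fintype.card G : ℝ) ≠ 0 := by exact_mod_cast Fintype.card_ne_zero
  have hS0 : (S : ℝ) ≠ 0 := by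
    intro h0
    rw [h0, mul_zero] at hS
    exact mul_ne_zero ht (neg_ne_zero.2 (mul_ne_zero hcard hC)) hS
  have hq : r χ = ((C.ncard - Fintype.card G * C.ncard * N χ / S : ℚ) : ℝ) := by
    push_cast
    have h2 := hN χ
    rw [hr0] at h2
    have h3 : t * ((r χ - C.ncard) * S + Fintype.card G * C.ncard * N χ) = 0 := by
      have : t * ((r χ - C.ncard) * S + Fintype.card G * C.ncard * N χ) =
        (t * (r χ - C.ncard)) * S - (t * (-(Fintype.card G * C.ncard))) * N χ := by ring
      rw [this, h2, hS]; ring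
    have h4 := (mul_eq_zero.1 h3).resolve_left ht
    field_simp
    linarith
  have hint := isIntegral_charSum C χ
  have hq' : charSum C χ = ((C.ncard - Fintype.card G * C.ncard * N χ / S : ℚ) : ℂ) := by
    rw [hr, hq]; push_cast; rfl
  rw [hq'] at hint ⊢
  obtain ⟨z, hz⟩ := hint.exists_int_of_ratCast
  exact ⟨z, by rw [hz]; simp⟩

lemma Int.exists_eq_two_pow_mul_odd' {n : ℤ} (hn : n ≠ 0) :
    ∃ (e : ℕ) (o : ℤ), Odd o ∧ n = 2 ^ e * o := by
  obtain ⟨e, o, ho, h⟩ := Nat.exists_eq_two_pow_mul_odd (Int.natAbs_ne_zero.2 hn)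
  rcases Int.natAbs_eq n with h' | h'
  · exact ⟨e, o, by exact_mod_cast ho, by rw [h', h]; push_cast; rfl⟩
  · refine ⟨e, -o, by simpa using ho, by rw [h', h]; push_cast; ring⟩

/-- Perfect state transfer on a Cayley graph takes place along an element of order two, the
spectrum is integral, and the `2`-adic valuations of the eigenvalue differences are determined. -/
lemma HasPST.exists_valuation [DecidableEq G] {C : Set G} (hneg : ∀ g ∈ C, -g ∈ C)
    (hzero : (0 : G) ∉ C) (h : HasPST (SimpleGraph.addCayley C)) :
    ∃ c : G, c ≠ 0 ∧ 2 • c = 0 ∧ IsPowerClosed C ∧ ∃ e : ℕ,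
      (∀ χ : AddChar G ℂ, χ c = 1 → ∃ z : ℤ, charSum C χ = charSum C 0 + 2 ^ (e + 1) * z) ∧
      (∀ χ : AddChar G ℂ, χ c = -1 →
        ∃ z : ℤ, charSum C χ = charSum C 0 + 2 ^ e + 2 ^ (e + 1) * z) := by
  rw [hasPST_iff C hneg hzero] at h
  obtain ⟨c, hc, t, h⟩ := h
  have hc2 := two_nsmul_eq_zero_of_phases hneg h
  have hreal : ∀ χ, ∃ x : ℝ, charSum C χ = x := fun χ =>
    Complex.conj_eq_iff_real.1 (charSum_conj C hneg χ)
  choose r hr using hreal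
  obtain ⟨N, hN⟩ := exists_int_phases hc2 hr h
  obtain ⟨χ₁, hχ₁⟩ := AddChar.exists_apply_ne_zero.2 hc
  have hodd : Odd (N χ₁) :=
    (hN χ₁).2.2 ((AddChar.apply_eq_one_or_neg_one hc2).resolve_left hχ₁)
  have hN1 : N χ₁ ≠ 0 := by rintro h0; rw [h0] at hodd; simp at hodd
  have hint := charSum_int_of_phases hzero hr (fun χ => (hN χ).1) hN1
  refine ⟨c, hc, hc2, isPowerClosed_of_charSum_int hint, ?_⟩
  choose z hz using hint
  have hrz : ∀ χ, r χ = z χ := fun χ => by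
    have := (hr χ).symm.trans (hz χ)
    exact_mod_cast this
  have hpi := Real.pi_ne_zero
  -- Comparison with the reference character `χ₁`, for which `N χ₁` is odd, eliminates `t` and `π`.
  have hcross : ∀ χ, N χ₁ * (z χ - z 0) = N χ * (z χ₁ - z 0) := fun χ => by
    have e1 := (hN χ).1
    have e2 := (hN χ₁).1
    rw [hrz, hrz] at e1 e2
    have : Real.pi * (N χ₁ * (z χ - z 0)) = Real.pi * (N χ * (z χ₁ - z 0)) := by
      rw [← mul_assoc, ← mul_assoc, ← e1, ← e2]; ring
    exact_mod_cast mul_left_cancel₀ hpi this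
  have hD : z χ₁ - z 0 ≠ 0 := by
    intro h0
    have e2 := (hN χ₁).1
    rw [hrz, hrz, ← Int.cast_sub, h0] at e2
    simp [hpi, hN1] at e2
  -- The exponent `e` is the 2-adic valuation of the eigenvalue difference at `χ₁`.
  obtain ⟨e, o, ho, he⟩ := Int.exists_eq_two_pow_mul_odd' hD
  have key : ∀ χ, ∃ w : ℤ, z χ - z 0 = 2 ^ e * w ∧ N χ₁ * w = N χ * o := fun χ => by
    have h1 := hcross χ
    rw [he] at h1
    have hcop : IsCoprime ((2 : ℤ) ^ e) (N χ₁) :=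
      IsCoprime.pow_left (Int.isCoprime_iff_gcd_eq_one.2 (by
        rw [Int.gcd_comm]; exact Int.isCoprime_iff_gcd_eq_one.1 (Int.isCoprime_two_right.2 hodd)))
    obtain ⟨w, hw⟩ := hcop.dvd_of_dvd_mul_left ⟨N χ * o, by rw [h1]; ring⟩
    refine ⟨w, hw, ?_⟩
    rw [hw] at h1
    have h2 : (2 : ℤ) ^ e ≠ 0 := by positivity
    apply mul_left_cancel₀ h2
    linear_combination h1
  refine ⟨e, fun χ hχ => ?_, fun χ hχ => ?_⟩
  · obtain ⟨w, hw, hw'⟩ := key χ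
    have hev : Even (N χ₁ * w) := by rw [hw']; exact ((hN χ).2.1 hχ).mul_right _
    rw [Int.even_mul] at hev
    obtain ⟨y, hy⟩ := hev.resolve_left (Int.not_even_iff_odd.2 hodd)
    refine ⟨y, ?_⟩
    rw [hz, hz]
    have : z χ = z 0 + 2 ^ (e + 1) * y := by
      rw [pow_succ]; linear_combination hw + 2 ^ e * hy
    exact_mod_cast this
  · obtain ⟨w, hw, hw'⟩ := key χ
    have hev : Odd (N χ₁ * w) := by rw [hw']; exact ((hN χ).2.2 hχ).mul ho
    obtain ⟨y, hy⟩ := (Int.odd_mul.1 hev).2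
    refine ⟨y, ?_⟩
    rw [hz, hz]
    have : z χ = z 0 + 2 ^ e + 2 ^ (e + 1) * y := by
      rw [pow_succ]; linear_combination hw + 2 ^ e * hy
    exact_mod_cast this

lemma hasPST_of_mod_four [DecidableEq G] {C : Set G} (hneg : ∀ g ∈ C, -g ∈ C)
    (hzero : (0 : G) ∉ C) {c : G} (hc : c ≠ 0) (hc2 : 2 • c = 0)
    (h1 : ∀ χ : AddChar G ℂ, χ c = 1 → ∃ z : ℤ, charSum C χ = charSum C 0 + 4 * z)
    (h2 : ∀ χ : AddChar G ℂ, χ c = -1 → ∃ z : ℤ, charSum C χ = charSum C 0 + 2 + 4 * z) :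
    HasPST (SimpleGraph.addCayley C) := by
  rw [hasPST_iff C hneg hzero]
  -- At time `π/2` an eigenvalue shift by 4 is invisible, while a shift by 2 changes the sign.
  refine ⟨c, hc, Real.pi / 2, fun χ => ?_⟩
  have hper : ∀ z : ℤ, exp (z * (2 * Real.pi * I)) = 1 := Complex.exp_int_mul_two_pi_mul_I
  rcases AddChar.apply_eq_one_or_neg_one (χ := χ) hc2 with h | h
  · obtain ⟨z, hz⟩ := h1 χ h
    have : I * ((Real.pi / 2 : ℝ) : ℂ) * (charSum C 0 + 4 * z) =
      I * ((Real.pi / 2 : ℝ) : ℂ) * charSum C 0 + z * (2 * Real.pi * I) := by push_cast; ring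
    rw [hz, h, this, Complex.exp_add, hper, mul_one, mul_one]
  · obtain ⟨z, hz⟩ := h2 χ h
    have : I * ((Real.pi / 2 : ℝ) : ℂ) * (charSum C 0 + 2 + 4 * z) =
      I * ((Real.pi / 2 : ℝ) : ℂ) * charSum C 0 + z * (2 * Real.pi * I) + Real.pi * I := by
      push_cast; ring
    rw [hz, h, this, Complex.exp_add, Complex.exp_add, hper, Complex.exp_pi_mul_I]
    ring

end

end

/-! ### Groups with cyclic Sylow 2-subgroup: the chain of 2-subgroups and the odd projection. -/

section
variable {G : Type*} [AddCommGroup G]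

lemma exists_generator_two_primary [Fintype G] {d m : ℕ} (hm : Odd m)
    (hG : Nat.card G = 2 ^ d * m) (hSylow : ∀ P : Sylow 2 (Multiplicative G), IsCyclic P) :
    ∃ x : G, addOrderOf x = 2 ^ d ∧ ∀ p : G, 2 ^ d • p = 0 → p ∈ AddSubgroup.zmultiples x := by
  have hp : Fact (Nat.Prime 2) := ⟨Nat.prime_two⟩
  obtain ⟨P⟩ : Nonempty (Sylow 2 (Multiplicative G)) := inferInstance
  have hcard : Nat.card P = 2 ^ d := by
    rw [P.card_eq_multiplicity]
    have h2 : Nat.card (Multiplicative G) = 2 ^ d * m := by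
      rw [← hG]; exact Nat.card_congr Multiplicative.toAdd
    rw [h2, Nat.factorization_mul (by positivity) hm.pos.ne',
      Nat.Prime.factorization_pow Nat.prime_two]
    simp [Nat.factorization_eq_zero_of_not_dvd hm.not_two_dvd_nat]
  obtain ⟨⟨x, hx⟩, hgen⟩ := (hSylow P).exists_generator
  have hPz : (P : Subgroup (Multiplicative G)) = Subgroup.zpowers x := by
    apply le_antisymm
    · intro y hy
      obtain ⟨k, hk⟩ := hgen ⟨y, hy⟩
      exact ⟨k, congrArg Subtype.val hk⟩
    · exact (Subgroup.zpowers_le).2 hx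
  refine ⟨x.toAdd, ?_, fun p hp' => ?_⟩
  · have : orderOf x = 2 ^ d := by
      rw [← Nat.card_zpowers, ← hPz]; exact hcard
    exact this
  · have hpg : IsPGroup 2 (Subgroup.zpowers (Multiplicative.ofAdd p)) := by
      refine IsPGroup.of_card_dvd_pow (n := d) ?_
      rw [Nat.card_zpowers]
      exact orderOf_dvd_of_pow_eq_one hp'
    obtain ⟨Q, hQ⟩ := hpg.exists_le_sylow
    have hQP : Q = P := by
      obtain ⟨g, hg⟩ := MulAction.exists_smul_eq (Multiplicative G) Q P
      rw [← hg]
      exact (Sylow.smul_eq_of_normal).symm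
    have : Multiplicative.ofAdd p ∈ (P : Subgroup (Multiplicative G)) :=
      hQP ▸ hQ (Subgroup.mem_zpowers _)
    rw [hPz] at this
    obtain ⟨k, hk⟩ := this
    exact ⟨k, hk⟩

lemma exists_odd_inverse_smul {d : ℕ} {i : ℤ} (hi : Odd i) :
    ∃ w : ℤ, ∀ p : G, 2 ^ d • p = 0 → w • i • p = p := by
  have h2 : IsCoprime i ((2 : ℤ) ^ d) := (Int.isCoprime_two_right.2 hi).pow_right
  obtain ⟨w, v, h⟩ := h2
  refine ⟨w, fun p hp => ?_⟩
  have h0 : ((v * 2 ^ d : ℤ)) • p = 0 := by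
    rw [mul_smul]
    have : ((2 : ℤ) ^ d) • p = 0 := by rw [← hp, ← natCast_zsmul]; norm_cast
    rw [this, smul_zero]
  rw [← mul_smul, ← add_zero ((w * i) • p), ← h0, ← add_smul, h, one_smul]

lemma mem_zmultiples_total {d : ℕ} {x : G}
    (hx : ∀ p : G, 2 ^ d • p = 0 → p ∈ AddSubgroup.zmultiples x) {p c : G}
    (hp : 2 ^ d • p = 0) (hc : 2 ^ d • c = 0) (hxd : 2 ^ d • x = 0) :
    c ∈ AddSubgroup.zmultiples p ∨ p ∈ AddSubgroup.zmultiples c := by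
  obtain ⟨i, rfl⟩ := hx p hp
  obtain ⟨j, rfl⟩ := hx c hc
  by_cases hi : i = 0
  · right; simp [hi, zero_mem]
  by_cases hj : j = 0
  · left; simp [hj, zero_mem]
  obtain ⟨α, i', hi', rfl⟩ := Int.exists_eq_two_pow_mul_odd' hi
  obtain ⟨β, j', hj', rfl⟩ := Int.exists_eq_two_pow_mul_odd' hj
  have key : ∀ (α β : ℕ) (i' j' : ℤ), Odd i' → α ≤ β →
      ((2 : ℤ) ^ β * j') • x ∈ AddSubgroup.zmultiples (((2 : ℤ) ^ α * i') • x) := by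
    intro α β i' j' hi' hab
    obtain ⟨w, hw⟩ := exists_odd_inverse_smul (G := G) (d := d) hi'
    obtain ⟨γ, rfl⟩ := Nat.exists_eq_add_of_le hab
    refine ⟨2 ^ γ * j' * w, ?_⟩
    have h1 := hw x hxd
    change (2 ^ γ * j' * w) • ((2 : ℤ) ^ α * i') • x = _
    conv_rhs => rw [← h1]
    simp only [smul_smul]
    congr 1
    ring
  rcases le_total α β with h | h
  · left; exact key α β i' j' hi' h
  · right; exact key β α j' i' hj' h

/-- An odd `s` could be inverted on the 2-part, which would put `p` back into `⟨c⟩`. -/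
lemma exists_even_smul_eq {d : ℕ} {p c : G} (hp : 2 ^ d • p = 0)
    (h : c ∈ AddSubgroup.zmultiples p ∨ p ∈ AddSubgroup.zmultiples c)
    (hpc : p ∉ AddSubgroup.zmultiples c) : ∃ s : ℤ, Even s ∧ c = s • p := by
  obtain ⟨s, hs⟩ := h.resolve_right hpc
  refine ⟨s, ?_, hs.symm⟩
  by_contra hodd
  rw [Int.not_even_iff_odd] at hodd
  obtain ⟨w, hw⟩ := exists_odd_inverse_smul (G := G) (d := d) hodd
  refine hpc ⟨w, ?_⟩
  change w • c = p
  rw [← hs]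
  exact hw p hp

lemma mem_zmultiples_of_addOrderOf_two {a g : G} (ha : addOrderOf a = 2) :
    g ∈ AddSubgroup.zmultiples a ↔ g = 0 ∨ g = a := by
  have ha2 : 2 • a = 0 := by rw [← ha, addOrderOf_nsmul_eq_zero]
  constructor
  · rintro ⟨i, rfl⟩
    change i • a = 0 ∨ i • a = a
    rcases Int.even_or_odd' i with ⟨k, rfl | rfl⟩
    · left; rw [mul_comm, mul_smul, ofNat_zsmul, ha2, smul_zero]
    · right; rw [add_smul, mul_comm, mul_smul, ofNat_zsmul, ha2, smul_zero, one_smul, zero_add]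
  · rintro (rfl | rfl)
    exacts [zero_mem _, AddSubgroup.mem_zmultiples _]

lemma addOrderOf_two_nsmul_of_four {b : G} (hb : addOrderOf b = 4) : addOrderOf (2 • b) = 2 := by
  rw [addOrderOf_nsmul' b two_ne_zero, hb]; norm_num

lemma mem_zmultiples_of_addOrderOf_four {b g : G} (hb : addOrderOf b = 4) :
    g ∈ AddSubgroup.zmultiples b ↔ g = 0 ∨ g = 2 • b ∨ g = b ∨ g = -b := by
  constructor
  · rintro ⟨i, rfl⟩
    change i • b = 0 ∨ i • b = 2 • b ∨ i • b = b ∨ i • b = -b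
    rcases Int.even_or_odd' i with ⟨k, rfl | rfl⟩
    · have := (mem_zmultiples_of_addOrderOf_two (addOrderOf_two_nsmul_of_four hb)
        (g := (2 * k) • b)).1 ⟨k, by
          change k • 2 • b = _; rw [mul_comm, mul_smul, ofNat_zsmul]⟩
      tauto
    · have := (mem_zmultiples_of_addOrderOf_two (addOrderOf_two_nsmul_of_four hb)
        (g := (2 * k) • b)).1 ⟨k, by
          change k • 2 • b = _; rw [mul_comm, mul_smul, ofNat_zsmul]⟩
      have h4 : 4 • b = 0 := by rw [← hb, addOrderOf_nsmul_eq_zero]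
      rw [add_smul, one_smul]
      rcases this with h | h
      · rw [h]; simp
      · rw [h]; right; right; right
        rw [eq_neg_iff_add_eq_zero, ← h4]; abel
  · rintro (rfl | rfl | rfl | rfl)
    exacts [zero_mem _, nsmul_mem (AddSubgroup.mem_zmultiples _) _,
      AddSubgroup.mem_zmultiples _, neg_mem (AddSubgroup.mem_zmultiples _)]

lemma eq_of_addOrderOf_two {a a' : G} (ha : addOrderOf a = 2) (ha' : addOrderOf a' = 2)
    (h : a ∈ AddSubgroup.zmultiples a' ∨ a' ∈ AddSubgroup.zmultiples a) : a = a' := by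
  have h0 : a ≠ 0 := by rintro rfl; simp at ha
  have h0' : a' ≠ 0 := by rintro rfl; simp at ha'
  rw [mem_zmultiples_of_addOrderOf_two ha, mem_zmultiples_of_addOrderOf_two ha'] at h
  rcases h with h | h
  · exact h.resolve_left h0
  · exact (h.resolve_left h0').symm

lemma eq_or_eq_neg_of_addOrderOf_four {b g : G} (hb : addOrderOf b = 4) (hg : addOrderOf g = 4)
    (h : b ∈ AddSubgroup.zmultiples g ∨ g ∈ AddSubgroup.zmultiples b) : g = b ∨ g = -b := by
  have key : ∀ {x y : G}, addOrderOf x = 4 → addOrderOf y = 4 → x ∈ AddSubgroup.zmultiples y →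
      x = y ∨ x = -y := by
    intro x y hx hy hxy
    rw [mem_zmultiples_of_addOrderOf_four hy] at hxy
    rcases hxy with rfl | rfl | h | h
    · simp at hx
    · rw [addOrderOf_two_nsmul_of_four hy] at hx; norm_num at hx
    · exact Or.inl h
    · exact Or.inr h
  rcases h with h | h
  · rcases key hb hg h with h | h
    · exact Or.inl h.symm
    · right; rw [h, neg_neg]
  · exact key hg hb h

lemma ne_neg_of_addOrderOf_four {b : G} (hb : addOrderOf b = 4) : b ≠ -b := by
  intro h
  have h2 : 2 • b = 0 := by rw [two_nsmul]; nth_rewrite 1 [h]; simp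
  have := addOrderOf_two_nsmul_of_four hb
  rw [h2] at this
  simp at this

/-- The integer `N` is the idempotent projecting a group of order `2 ^ d * m` onto its
`m`-torsion. -/
structure IsOddProjector (d m : ℕ) (N : ℤ) : Prop where
  dvd : (2 : ℤ) ^ d ∣ N
  dvd_one_sub : (m : ℤ) ∣ 1 - N

lemma exists_isOddProjector (d : ℕ) {m : ℕ} (hm : Odd m) : ∃ N, IsOddProjector d m N := by
  have : IsCoprime ((2 : ℤ) ^ d) m :=
    (Int.isCoprime_two_left.2 (by exact_mod_cast hm)).pow_left
  obtain ⟨u, v, h⟩ := this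
  exact ⟨u * 2 ^ d, dvd_mul_left _ _, ⟨v, by linear_combination -h⟩⟩

namespace IsOddProjector
variable {d m : ℕ} {N : ℤ} (hN : IsOddProjector d m N)
include hN

lemma smul_eq_zero {p : G} (hp : 2 ^ d • p = 0) : N • p = 0 := by
  obtain ⟨u, rfl⟩ := hN.dvd
  rw [mul_comm, mul_smul]
  have : ((2 : ℤ) ^ d) • p = 0 := by rw [← hp, ← natCast_zsmul]; norm_cast
  rw [this, smul_zero]

lemma smul_eq_self {h : G} (hh : m • h = 0) : N • h = h := by
  obtain ⟨v, hv⟩ := hN.dvd_one_sub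
  have : (1 - N) • h = 0 := by rw [hv, mul_comm, mul_smul, natCast_zsmul, hh, smul_zero]
  rw [sub_smul, one_smul, sub_eq_zero] at this
  exact this.symm

lemma one_sub_smul_eq_zero {h : G} (hh : m • h = 0) : (1 - N) • h = 0 := by
  rw [sub_smul, one_smul, hN.smul_eq_self hh, sub_self]

lemma one_sub_smul_eq_self {p : G} (hp : 2 ^ d • p = 0) : (1 - N) • p = p := by
  rw [sub_smul, one_smul, hN.smul_eq_zero hp, sub_zero]

lemma nsmul_smul [Fintype G] (hG : Nat.card G = 2 ^ d * m) (g : G) : m • N • g = 0 := by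
  obtain ⟨u, rfl⟩ := hN.dvd
  have h : (2 ^ d * m) • g = 0 := by rw [← hG]; exact card_nsmul_eq_zero'
  rw [← natCast_zsmul, smul_smul]
  have : (m : ℤ) * (2 ^ d * u) = u * ((2 ^ d * m : ℕ) : ℤ) := by push_cast; ring
  rw [this, mul_smul, natCast_zsmul, h, smul_zero]

lemma nsmul_one_sub_smul [Fintype G] (hG : Nat.card G = 2 ^ d * m) (g : G) :
    2 ^ d • (1 - N) • g = 0 := by
  obtain ⟨v, hv⟩ := hN.dvd_one_sub
  have h : (2 ^ d * m) • g = 0 := by rw [← hG]; exact card_nsmul_eq_zero'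
  rw [hv, ← natCast_zsmul, smul_smul]
  have : ((2 ^ d : ℕ) : ℤ) * (m * v) = v * ((2 ^ d * m : ℕ) : ℤ) := by push_cast; ring
  rw [this, mul_smul, natCast_zsmul, h, smul_zero]

omit hN in
lemma one_sub_smul_add_smul (N : ℤ) (g : G) : (1 - N) • g + N • g = g := by
  rw [← add_smul, sub_add_cancel, one_smul]

/-- By the Chinese remainder theorem `r * N + s * (1 - N)` acts as `s` on the 2-part and as `r` on
the odd part, and it is coprime to `|G|`. -/
lemma mem_iff [Fintype G] (hG : Nat.card G = 2 ^ d * m) {C : Set G} (hC : IsPowerClosed C)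
    {p h : G} (hp : 2 ^ d • p = 0) (hh : m • h = 0) {s r : ℤ} (hs : Odd s)
    (hr : IsCoprime r (m : ℤ)) : s • p + r • h ∈ C ↔ p + h ∈ C := by
  obtain ⟨u, hu⟩ := hN.dvd
  obtain ⟨v, hv⟩ := hN.dvd_one_sub
  have hk : IsCoprime (r * N + s * (1 - N)) (Fintype.card G : ℤ) := by
    rw [← Nat.card_eq_fintype_card, hG]
    push_cast
    apply IsCoprime.mul_right
    · have : r * N + s * (1 - N) = s + (r - s) * u * 2 ^ d := by rw [hu]; ring
      rw [this]
      exact ((Int.isCoprime_two_right.2 hs).pow_right).add_mul_right_left _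
    · have : r * N + s * (1 - N) = r + (s - r) * v * m := by
        linear_combination (s - r) * hv
      rw [this]
      exact hr.add_mul_right_left _
  rw [← hC.zsmul_mem_iff hk (p + h)]
  have : (r * N + s * (1 - N)) • (p + h) = s • p + r • h := by
    rw [add_smul, mul_smul, mul_smul, smul_add, smul_add, smul_add, smul_add, hN.smul_eq_zero hp, hN.smul_eq_self hh,
      hN.one_sub_smul_eq_zero hh, hN.one_sub_smul_eq_self hp, smul_zero, smul_zero, zero_add, add_zero, add_comm]
  rw [this]

/-- Here `c` is an even multiple `s • p` of the 2-part `p` of `g`, so adding `c` multiplies `p` by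
the odd number `1 + s`. -/
lemma add_mem_iff [Fintype G] (hG : Nat.card G = 2 ^ d * m) {C : Set G} (hC : IsPowerClosed C)
    (htot : ∀ p c : G, 2 ^ d • p = 0 → 2 ^ d • c = 0 →
      c ∈ AddSubgroup.zmultiples p ∨ p ∈ AddSubgroup.zmultiples c)
    {c g : G} (hc : 2 ^ d • c = 0) (hg : (1 - N) • g ∉ AddSubgroup.zmultiples c) :
    g + c ∈ C ↔ g ∈ C := by
  have hp := hN.nsmul_one_sub_smul hG g
  obtain ⟨s, hs, hcs⟩ := exists_even_smul_eq hp (htot _ c hp hc) hg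
  have h1 := hN.mem_iff hG hC hp (hN.nsmul_smul hG g) (s := 1 + s) (r := 1)
    (odd_one.add_even hs) isCoprime_one_left
  rw [one_sub_smul_add_smul] at h1
  rw [← h1, add_smul, one_smul, ← hcs, one_smul, add_right_comm, one_sub_smul_add_smul]

end IsOddProjector
end

/-! ### Fourier inversion modulo powers of two and sums over fibres of the odd projection. -/

section
variable {A : Type*} [AddCommGroup A] [Fintype A]

/-- A Fourier inversion argument modulo an integer coprime to the order of the group. -/
lemma dvd_of_fourier_congr [DecidableEq A] {q c : ℤ} (hq : IsCoprime q (Fintype.card A : ℤ))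
    {f : A → ℤ} (h : ∀ φ : AddChar A ℂ, ∃ z : ℤ, ∑ x, (f x : ℂ) * φ x = c + q * z) (x : A) :
    q ∣ f x - if x = 0 then c else 0 := by
  choose z hz using h
  -- Inversion produces a factor `|A|`, removed at the end by coprimality with `q`; the constant `c`
  -- transforms into a point mass at `0`.
  have h1 : (((Fintype.card A : ℤ) * (f x - if x = 0 then c else 0) : ℤ) : ℂ) =
      q * ∑ φ : AddChar A ℂ, z φ * φ (-x) := by
    have h2 : ∑ φ : AddChar A ℂ, (∑ y, (f y : ℂ) * φ y) * φ (-x) = Fintype.card A * f x := by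
      simp only [Finset.sum_mul]
      rw [Finset.sum_comm]
      simp_rw [mul_assoc, ← AddChar.map_add_eq_mul, ← sub_eq_add_neg, ← Finset.mul_sum,
        AddChar.sum_apply_eq_ite, sub_eq_zero]
      simp [mul_comm]
    have h3 : ∑ φ : AddChar A ℂ, (c : ℂ) * φ (-x) =
        Fintype.card A * (if x = 0 then c else 0 : ℤ) := by
      rw [← Finset.mul_sum, AddChar.sum_apply_eq_ite]
      by_cases hx : x = 0 <;> simp [hx, mul_comm]
    rw [Int.cast_mul, Int.cast_sub, mul_sub, Int.cast_natCast, ← h2, ← h3,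
      ← Finset.sum_sub_distrib, Finset.mul_sum]
    refine Finset.sum_congr rfl fun φ _ => ?_
    rw [hz]; ring
  refine hq.dvd_of_dvd_mul_left (Int.dvd_of_mul_isIntegral ?_ h1)
  refine IsIntegral.sum _ fun φ _ => IsIntegral.mul ?_ (φ.isIntegral_apply _)
  simpa using isIntegral_algebraMap (R := ℤ) (A := ℂ) (x := z φ)

/-- If `χ b = 1`, the summand is constant on cosets of `⟨b⟩`. Otherwise translation by `b`
multiplies the sum by `χ b ≠ 1`, so it vanishes. -/
lemma exists_isIntegral_charSum_eq_mul {E : Set A} {b : A} (hE : ∀ g, g + b ∈ E ↔ g ∈ E)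
    (χ : AddChar A ℂ) : ∃ x : ℂ, IsIntegral ℤ x ∧ charSum E χ = addOrderOf b * x := by
  classical
  by_cases hb : χ b = 1
  · let K := AddSubgroup.zmultiples b
    have hw1 : ∀ g, E.indicator χ (g + b) = E.indicator χ g := fun g => by
      simp only [Set.indicator_apply, hE, AddChar.map_add_eq_mul, hb, mul_one]
    have hw : ∀ k ∈ K, ∀ g, E.indicator χ (g + k) = E.indicator χ g := by
      rintro _ ⟨i, rfl⟩
      induction i using Int.induction_on with
      | zero => simp
      | succ i ih => intro g; simpa [add_smul, ← add_assoc, hw1] using ih g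
      | pred i ih =>
        intro g
        rw [← hw1]
        simpa [sub_smul, add_assoc] using ih g
    refine ⟨∑ q : A ⧸ K, E.indicator χ q.out, IsIntegral.sum _ fun q _ => ?_, ?_⟩
    · rw [Set.indicator_apply]
      split_ifs
      exacts [χ.isIntegral_apply _, isIntegral_zero]
    · have h1 : charSum E χ = ∑ y : (A ⧸ K) × K, E.indicator χ y.1.out := by
        symm
        refine Fintype.sum_bijective (fun y : (A ⧸ K) × K => y.1.out + y.2) ⟨?_, ?_⟩ _ _
          fun y => (hw _ y.2.2 _).symm
        · rintro ⟨q, k⟩ ⟨q', k'⟩ hqk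
          have hq : q = q' := by
            have := congrArg (QuotientAddGroup.mk : A → A ⧸ K) hqk
            rwa [QuotientAddGroup.mk_add_of_mem _ k.2, QuotientAddGroup.mk_add_of_mem _ k'.2,
              QuotientAddGroup.out_eq', QuotientAddGroup.out_eq'] at this
          subst hq
          simpa using hqk
        · intro g
          refine ⟨(g, ⟨-(g : A ⧸ K).out + g, ?_⟩), by simp⟩
          rw [← QuotientAddGroup.eq, QuotientAddGroup.out_eq']
      rw [h1, Fintype.sum_prod_type]
      simp only [Finset.sum_const, nsmul_eq_mul]
      rw [← Finset.mul_sum, Finset.card_univ, ← Nat.card_eq_fintype_card, Nat.card_zmultiples]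
  · refine ⟨0, isIntegral_zero, ?_⟩
    have h1 : charSum E χ = χ b * charSum E χ := by
      rw [charSum, Finset.mul_sum]
      symm
      refine Fintype.sum_equiv (Equiv.addRight b) _ _ fun g => ?_
      simp only [Equiv.coe_addRight, Set.indicator_apply, hE, AddChar.map_add_eq_mul]
      split_ifs <;> ring
    have h2 : (1 - χ b) * charSum E χ = 0 := by linear_combination h1
    rw [mul_zero]
    exact (mul_eq_zero.1 h2).resolve_left (sub_ne_zero.2 (Ne.symm hb))

end

section
variable {G : Type*} [AddCommGroup G] [Fintype G] [DecidableEq G]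

namespace IsOddProjector
variable {d m : ℕ} {N : ℤ} (hN : IsOddProjector d m N)
include hN

/-- Over a fibre of the projection onto the `m`-torsion, the sum of a character which is nontrivial
at `c` is supported on a coset of `⟨c⟩`; the same is trivially true if `⟨c⟩` is the whole `2`-part. -/
lemma sum_fiber (hG : Nat.card G = 2 ^ d * m) {C : Set G} (hC : IsPowerClosed C)
    (htot : ∀ p c : G, 2 ^ d • p = 0 → 2 ^ d • c = 0 →
      c ∈ AddSubgroup.zmultiples p ∨ p ∈ AddSubgroup.zmultiples c)
    {c h : G} (hc : 2 ^ d • c = 0) (hh : m • h = 0) {ψ : AddChar G ℂ}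
    (hψ : ψ c ≠ 1 ∨ ∀ p : G, 2 ^ d • p = 0 → p ∈ AddSubgroup.zmultiples c)
    {D : Finset G} (hD : ∀ x, x ∈ D ↔ x ∈ AddSubgroup.zmultiples c) :
    ∑ g with N • g = h, C.indicator ψ g = ∑ x ∈ D, C.indicator ψ (x + h) := by
  classical
  rw [← Finset.sum_filter_add_sum_filter_not (Finset.univ.filter fun g => N • g = h)
    (fun g => (1 - N) • g ∈ AddSubgroup.zmultiples c)]
  have hNc := hN.smul_eq_zero hc
  have hNc' := hN.one_sub_smul_eq_self hc
  have h2 : ∑ g ∈ (Finset.univ.filter fun g => N • g = h).filter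
      (fun g => ¬ (1 - N) • g ∈ AddSubgroup.zmultiples c), C.indicator ψ g = 0 := by
    rcases hψ with hψ | hall
    swap
    · refine Finset.sum_eq_zero fun g hg => ?_
      exact absurd (hall _ (hN.nsmul_one_sub_smul hG g)) (Finset.mem_filter.1 hg).2
    set T := (Finset.univ.filter fun g => N • g = h).filter
      (fun g => ¬ (1 - N) • g ∈ AddSubgroup.zmultiples c) with hT
    -- Off the coset, translation by `c` permutes `T` and preserves membership in `C`, so it only
    -- scales the sum by `ψ c`.
    have h3 : ∑ g ∈ T, C.indicator ψ g = ψ c * ∑ g ∈ T, C.indicator ψ g := by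
      rw [Finset.mul_sum]
      symm
      refine Finset.sum_equiv (Equiv.addRight c) (fun g => ?_) (fun g hg => ?_)
      · simp only [hT, Finset.mem_filter, Finset.mem_univ, true_and, Equiv.coe_addRight, smul_add,
          hNc, hNc', add_zero,
          AddSubgroup.add_mem_cancel_right _ (AddSubgroup.mem_zmultiples c)]
      · simp only [hT, Finset.mem_filter, Finset.mem_univ, true_and] at hg
        simp only [Equiv.coe_addRight, Set.indicator_apply, hN.add_mem_iff hG hC htot hc hg.2,
          AddChar.map_add_eq_mul]
        split_ifs <;> ring
    have h4 : (1 - ψ c) * ∑ g ∈ T, C.indicator ψ g = 0 := by linear_combination h3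
    exact (mul_eq_zero.1 h4).resolve_left (sub_ne_zero.2 (Ne.symm hψ))
  rw [h2, add_zero]
  have hsmul : ∀ x ∈ AddSubgroup.zmultiples c, N • x = 0 ∧ (1 - N) • x = x := by
    rintro x ⟨i, rfl⟩
    change N • i • c = 0 ∧ (1 - N) • i • c = i • c
    rw [smul_comm, hNc, smul_zero, smul_comm, hNc']
    exact ⟨rfl, rfl⟩
  symm
  refine Finset.sum_bij (fun x _ => x + h) (fun x hx => ?_) (fun x _ y _ hxy => by simpa using hxy)
    (fun g hg => ?_) (fun _ _ => rfl)
  · rw [hD] at hx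
    obtain ⟨e1, e2⟩ := hsmul x hx
    simp only [Finset.mem_filter, Finset.mem_univ, true_and, smul_add, e1, e2,
      hN.smul_eq_self hh, hN.one_sub_smul_eq_zero hh, zero_add, add_zero, hx]
  · simp only [Finset.mem_filter, Finset.mem_univ, true_and] at hg
    exact ⟨(1 - N) • g, (hD _).2 hg.2, by rw [← hg.1, one_sub_smul_add_smul]⟩

omit hN in
/-- The fibre sums determine the character sums of all twists by characters of the `m`-torsion. -/
lemma charSum_add_comp (C : Set G) (ψ : AddChar G ℂ) {H : AddSubgroup G} (π : G →+ H)
    [Fintype H] (hπ : ∀ g, (π g : G) = N • g) (φ : AddChar H ℂ) :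
    charSum C (ψ + φ.compAddMonoidHom π) =
      ∑ h : H, (∑ g with N • g = (h : G), C.indicator ψ g) * φ h := by
  classical
  rw [charSum, ← Finset.sum_fiberwise Finset.univ π]
  refine Finset.sum_congr rfl fun h _ => ?_
  rw [Finset.sum_mul]
  have : (Finset.univ.filter fun g => π g = h) = Finset.univ.filter fun g => N • g = (h : G) := by
    ext g
    simp only [Finset.mem_filter, Finset.mem_univ, true_and, ← hπ, Subtype.ext_iff]
  rw [← this]
  refine Finset.sum_congr rfl fun g hg => ?_
  simp only [Finset.mem_filter, Finset.mem_univ, true_and] at hg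
  simp only [Set.indicator_apply]
  split_ifs
  · rw [AddChar.add_apply, AddChar.compAddMonoidHom_apply, hg]
  · simp

omit [DecidableEq G] in
lemma exists_projection (hG : Nat.card G = 2 ^ d * m) (hm : Odd m) :
    ∃ (H : AddSubgroup G) (π : G →+ H), (∀ h, h ∈ H ↔ m • h = 0) ∧ (∀ g, (π g : G) = N • g) ∧
      Odd (Nat.card H) := by
  let H : AddSubgroup G := (nsmulAddMonoidHom m : G →+ G).ker
  refine ⟨H, (zsmulAddGroupHom N : G →+ G).codRestrict H fun g => hN.nsmul_smul hG g,
    fun h => Iff.rfl, fun g => rfl, ?_⟩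
  by_contra hodd
  rw [Nat.not_odd_iff_even, even_iff_two_dvd] at hodd
  have : Fact (Nat.Prime 2) := ⟨Nat.prime_two⟩
  obtain ⟨⟨x, hx⟩, hx2⟩ := exists_prime_addOrderOf_dvd_card' 2 hodd
  rw [← AddSubgroup.addOrderOf_coe] at hx2
  have hmx : m • x = 0 := hx
  have := addOrderOf_dvd_of_nsmul_eq_zero hmx
  rw [hx2] at this
  exact hm.not_two_dvd_nat this

end IsOddProjector
end

/-- Applied to the congruence at odd part `0`, this pins down the unknown valuation `e`. -/
lemma eq_one_of_two_pow_succ_dvd {e : ℕ} {x : ℤ} (hx : x = -1 ∨ x = 0 ∨ x = 1)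
    (h : (2 : ℤ) ^ (e + 1) ∣ 2 * x + 2 ^ e) : e = 1 ∧ x ≠ 0 := by
  match e, h with
  | 0, h => norm_num at h
  | 1, h => norm_num at h; omega
  | k + 2, h =>
    exfalso
    have h8 : (8 : ℤ) * 2 ^ k = 2 ^ (k + 2 + 1) := by ring
    have h4 : (4 : ℤ) * 2 ^ k = 2 ^ (k + 2) := by ring
    have hpos : (0 : ℤ) < 2 ^ k := by positivity
    rw [← h8, ← h4] at h
    obtain ⟨y, hy⟩ := h
    have hx0 : x = 0 := by
      have : x = 2 * (2 * 2 ^ k * y - 2 ^ k) := by linarith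
      omega
    rw [hx0] at hy
    have : (2 ^ k : ℤ) * (2 * y - 1) = 0 := by linarith
    rcases mul_eq_zero.1 this with h | h
    · exact hpos.ne' h
    · omega

/-! ### Necessary conditions for perfect state transfer. -/

section
variable {G : Type*} [AddCommGroup G] [Fintype G] [DecidableEq G]

omit [Fintype G] [DecidableEq G] in
lemma indicator_char_eq (C : Set G) (ψ : AddChar G ℂ) (x h : G) (hψ : ψ h = 1) :
    C.indicator ψ (x + h) = (C.indicator (1 : G → ℤ) (x + h) : ℤ) * ψ x := by
  by_cases hx : x + h ∈ C <;> simp [hx, AddChar.map_add_eq_mul, hψ]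

omit [AddCommGroup G] [Fintype G] [DecidableEq G] in
lemma indicator_one_eq_zero_or_one (C : Set G) (x : G) :
    C.indicator (1 : G → ℤ) x = 0 ∨ C.indicator (1 : G → ℤ) x = 1 := by
  by_cases hx : x ∈ C <;> simp [hx]

omit [AddCommGroup G] [Fintype G] [DecidableEq G] in
lemma indicator_one_eq_iff (C : Set G) (x y : G) :
    C.indicator (1 : G → ℤ) x = C.indicator (1 : G → ℤ) y ↔ (x ∈ C ↔ y ∈ C) := by
  by_cases hx : x ∈ C <;> by_cases hy : y ∈ C <;> simp [hx, hy]

omit [DecidableEq G] in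
/-- A character which is `-1` on the element of order two and trivial on the `m`-torsion. -/
lemma exists_char_neg_one {m : ℕ} (hm : Odd m) {a : G} (ha : a ≠ 0) (ha2 : 2 • a = 0) :
    ∃ ψ : AddChar G ℂ, ψ a = -1 ∧ ∀ h, m • h = 0 → ψ h = 1 := by
  obtain ⟨χ, hχ⟩ := AddChar.exists_apply_ne_zero.2 ha
  have h1 := (AddChar.apply_eq_one_or_neg_one (χ := χ) ha2).resolve_left hχ
  -- Multiplication by the odd `m` keeps the value `-1` at `a` and trivialises the `m`-torsion.
  refine ⟨m • χ, by rw [AddChar.nsmul_apply, h1, hm.neg_one_pow], fun h hh => ?_⟩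
  rw [AddChar.nsmul_apply, ← AddChar.map_nsmul_eq_pow, hh, AddChar.map_zero_eq_one]

namespace IsOddProjector
variable {d m : ℕ} {N : ℤ} (hN : IsOddProjector d m N)
include hN

/-- The characters agreeing with `ψ` on the 2-part include all twists of `ψ` by characters of the
`m`-torsion. The hypothesis thus controls the whole Fourier transform of `f` on a group of odd
order, where inversion modulo `2 ^ k` is possible. -/
lemma dvd_of_charSum_congr (hG : Nat.card G = 2 ^ d * m) (hm : Odd m) {C : Set G}
    {ψ : AddChar G ℂ} {f : G → ℤ}
    (hf : ∀ h, m • h = 0 → ∑ g with N • g = h, C.indicator ψ g = f h) {k : ℕ} {c : ℤ}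
    (hc : ∀ χ : AddChar G ℂ, (∀ p, 2 ^ d • p = 0 → χ p = ψ p) →
      ∃ z : ℤ, charSum C χ = c + 2 ^ k * z) {h : G} (hh : m • h = 0) :
    (2 : ℤ) ^ k ∣ f h - if h = 0 then c else 0 := by
  classical
  obtain ⟨H, π, hH, hπ, hodd⟩ := hN.exists_projection hG hm
  have hq : IsCoprime ((2 : ℤ) ^ k) (Fintype.card H : ℤ) := by
    rw [← Nat.card_eq_fintype_card]
    exact (Int.isCoprime_two_left.2 (by exact_mod_cast hodd)).pow_left
  have key := dvd_of_fourier_congr (f := fun x : H => f x) (c := c) hq (fun φ => ?_) ⟨h, (hH h).2 hh⟩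
  · simpa [Subtype.ext_iff] using key
  · obtain ⟨z, hz⟩ := hc (ψ + φ.compAddMonoidHom π) (fun p hp => by
      have : π p = 0 := by rw [Subtype.ext_iff, hπ, hN.smul_eq_zero hp]; rfl
      rw [AddChar.add_apply, AddChar.compAddMonoidHom_apply, this, AddChar.map_zero_eq_one,
        mul_one])
    refine ⟨z, ?_⟩
    rw [charSum_add_comp C ψ π hπ] at hz
    rw [Int.cast_pow, Int.cast_ofNat, ← hz]
    exact Finset.sum_congr rfl fun x _ => by rw [hf x ((hH x).1 x.2)]

lemma sum_fiber_of_neg_one (hG : Nat.card G = 2 ^ d * m) {C : Set G} (hC : IsPowerClosed C)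
    (htot : ∀ p c : G, 2 ^ d • p = 0 → 2 ^ d • c = 0 →
      c ∈ AddSubgroup.zmultiples p ∨ p ∈ AddSubgroup.zmultiples c)
    {a h : G} (ha : addOrderOf a = 2) (had : 2 ^ d • a = 0) (hh : m • h = 0) {ψ : AddChar G ℂ}
    (hψ : ψ a = -1) (hψh : ψ h = 1) :
    ∑ g with N • g = h, C.indicator ψ g =
      (C.indicator (1 : G → ℤ) h - C.indicator (1 : G → ℤ) (a + h) : ℤ) := by
  have ha0 : (0 : G) ≠ a := by rintro rfl; simp at ha
  rw [hN.sum_fiber hG hC htot had hh (Or.inl (by rw [hψ]; norm_num)) (D := {0, a})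
    (fun x => by rw [mem_zmultiples_of_addOrderOf_two ha]; simp)]
  rw [Finset.sum_pair ha0, indicator_char_eq C ψ _ _ hψh, indicator_char_eq C ψ _ _ hψh, hψ,
    AddChar.map_zero_eq_one, zero_add]
  push_cast
  ring

lemma sum_fiber_of_eq_zmultiples (hG : Nat.card G = 2 ^ d * m) {C : Set G} (hC : IsPowerClosed C)
    (htot : ∀ p c : G, 2 ^ d • p = 0 → 2 ^ d • c = 0 →
      c ∈ AddSubgroup.zmultiples p ∨ p ∈ AddSubgroup.zmultiples c)
    {a h : G} (ha : addOrderOf a = 2) (had : 2 ^ d • a = 0) (hh : m • h = 0)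
    (hall : ∀ p : G, 2 ^ d • p = 0 → p ∈ AddSubgroup.zmultiples a) :
    ∑ g with N • g = h, C.indicator (0 : AddChar G ℂ) g =
      (C.indicator (1 : G → ℤ) h + C.indicator (1 : G → ℤ) (a + h) : ℤ) := by
  have ha0 : (0 : G) ≠ a := by rintro rfl; simp at ha
  rw [hN.sum_fiber hG hC htot had hh (Or.inr hall) (D := {0, a})
    (fun x => by rw [mem_zmultiples_of_addOrderOf_two ha]; simp)]
  rw [Finset.sum_pair ha0, indicator_char_eq C 0 _ _ rfl, indicator_char_eq C 0 _ _ rfl,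
    zero_add]
  simp

/-- Only `h + ⟨b⟩` contributes. The coefficient 2 arises because `b + h` and `-b + h` are
power-equivalent and `ψ` is `-1` at both `b` and `-b`. -/
lemma sum_fiber_of_order_four (hG : Nat.card G = 2 ^ d * m) {C : Set G} (hC : IsPowerClosed C)
    (htot : ∀ p c : G, 2 ^ d • p = 0 → 2 ^ d • c = 0 →
      c ∈ AddSubgroup.zmultiples p ∨ p ∈ AddSubgroup.zmultiples c)
    {b h : G} (hb : addOrderOf b = 4) (hbd : 2 ^ d • b = 0) (hh : m • h = 0) {ψ : AddChar G ℂ}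
    (hψ : ψ b = -1) (hψh : ψ h = 1) :
    ∑ g with N • g = h, C.indicator ψ g =
      (C.indicator (1 : G → ℤ) h + C.indicator (1 : G → ℤ) (2 • b + h) -
        2 * C.indicator (1 : G → ℤ) (b + h) : ℤ) := by
  have h2b := addOrderOf_two_nsmul_of_four hb
  have hb0 : b ≠ 0 := by rintro rfl; simp at hb
  have h2b0 : 2 • b ≠ 0 := by intro h; rw [h] at h2b; simp at h2b
  have hbn := ne_neg_of_addOrderOf_four hb
  have h2bb : 2 • b ≠ b := by intro h; rw [h, hb] at h2b; norm_num at h2b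
  have h2bn : 2 • b ≠ -b := by intro h; rw [h, addOrderOf_neg, hb] at h2b; norm_num at h2b
  have hneg : C.indicator (1 : G → ℤ) (-b + h) = C.indicator (1 : G → ℤ) (b + h) := by
    rw [indicator_one_eq_iff]
    have := hN.mem_iff hG hC hbd hh (s := -1) (r := 1) (by decide) isCoprime_one_left
    simpa using this
  rw [hN.sum_fiber hG hC htot hbd hh (Or.inl (by rw [hψ]; norm_num)) (D := {0, 2 • b, b, -b})
    (fun x => by rw [mem_zmultiples_of_addOrderOf_four hb]; simp)]
  rw [Finset.sum_insert (by simp [hb0.symm, h2b0.symm, hb0]),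
    Finset.sum_insert (by simp [h2bb, h2bn]), Finset.sum_pair hbn]
  simp only [indicator_char_eq C ψ _ _ hψh]
  rw [hneg, AddChar.map_neg_eq_inv, AddChar.map_nsmul_eq_pow, hψ, AddChar.map_zero_eq_one, zero_add]
  push_cast
  norm_num
  ring

end IsOddProjector

/-- Odd-order Cayley graphs of abelian groups have no perfect state transfer. -/
lemma not_hasPST_of_odd_card (hodd : Odd (Nat.card G)) {C : Set G}
    (hneg : ∀ g ∈ C, -g ∈ C) (hzero : (0 : G) ∉ C) : ¬ HasPST (SimpleGraph.addCayley C) := by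
  intro h
  obtain ⟨c, hc, hc2, -⟩ := h.exists_valuation hneg hzero
  have h1 := addOrderOf_eq_prime hc2 hc
  have h2 : addOrderOf c ∣ Nat.card G := addOrderOf_dvd_natCard c
  rw [h1] at h2
  exact hodd.not_two_dvd_nat h2

omit [Fintype G] [DecidableEq G] in
lemma isPerfectMatching_addCayley_iff {C : Set G} (hneg : ∀ g ∈ C, -g ∈ C)
    (hzero : (0 : G) ∉ C) :
    (⊤ : (SimpleGraph.addCayley C).Subgraph).IsPerfectMatching ↔ ∃ c, C = {c} := by
  rw [SimpleGraph.Subgraph.isPerfectMatching_iff]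
  simp only [SimpleGraph.Subgraph.top_adj, addCayley_adj_iff C hneg hzero]
  constructor
  · intro h
    obtain ⟨c, hc, huniq⟩ := h 0
    refine ⟨c, Set.Subset.antisymm (fun g hg => huniq g (by simpa using hg)) ?_⟩
    rintro _ rfl
    simpa using hc
  · rintro ⟨c, rfl⟩ v
    refine ⟨v + c, by simp, fun w hw => ?_⟩
    simp only [Set.mem_singleton_iff] at hw
    rw [← hw]; abel

lemma charSum_singleton (c : G) (χ : AddChar G ℂ) : charSum {c} χ = χ c := by
  simp [charSum, Set.indicator_apply]

lemma hasPST_of_eq_singleton {c : G} (hneg : ∀ g ∈ ({c} : Set G), -g ∈ ({c} : Set G))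
    (hzero : (0 : G) ∉ ({c} : Set G)) : HasPST (SimpleGraph.addCayley ({c} : Set G)) := by
  have h1 : -c = c := hneg c rfl
  have h2 : 2 • c = 0 := by rw [two_nsmul]; nth_rewrite 1 [← h1]; simp
  have h0 : c ≠ 0 := fun h => hzero h.symm
  -- The eigenvalue is `χ c`, and `-1 = 1 + 2 + 4 * (-1)`.
  refine hasPST_of_mod_four hneg hzero h0 h2 (fun χ hχ => ⟨0, ?_⟩) (fun χ hχ => ⟨-1, ?_⟩)
  · rw [charSum_singleton, charSum_singleton, hχ]; simp
  · rw [charSum_singleton, charSum_singleton, hχ]; simp; norm_num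

/-- If the Sylow `2`-subgroup has order two, perfect state transfer forces the connection set to
be the unique involution. -/
lemma eq_singleton_of_hasPST {m : ℕ} (hm : Odd m) (hG : Nat.card G = 2 ^ 1 * m)
    (htot : ∀ p c : G, 2 ^ 1 • p = 0 → 2 ^ 1 • c = 0 →
      c ∈ AddSubgroup.zmultiples p ∨ p ∈ AddSubgroup.zmultiples c)
    {C : Set G} (hneg : ∀ g ∈ C, -g ∈ C) (hzero : (0 : G) ∉ C)
    (h : HasPST (SimpleGraph.addCayley C)) : ∃ c, C = {c} := by
  obtain ⟨N, hN⟩ := exists_isOddProjector 1 hm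
  obtain ⟨a, ha0, ha2, hC, e, h1, h2⟩ := h.exists_valuation hneg hzero
  have ha : addOrderOf a = 2 := addOrderOf_eq_prime ha2 ha0
  have had : 2 ^ 1 • a = 0 := by simpa using ha2
  have hall : ∀ p : G, 2 ^ 1 • p = 0 → p ∈ AddSubgroup.zmultiples a := by
    intro p hp
    by_cases hp0 : p = 0
    · rw [hp0]; exact zero_mem _
    · have hpo : addOrderOf p = 2 := addOrderOf_eq_prime (by simpa using hp) hp0
      rw [eq_of_addOrderOf_two hpo ha (htot a p had hp)]
      exact AddSubgroup.mem_zmultiples a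
  obtain ⟨ψ, hψa, hψh⟩ := exists_char_neg_one hm ha0 ha2
  have hA := fun h hh => hN.dvd_of_charSum_congr hG hm (C := C) (ψ := ψ)
    (fun h hh => hN.sum_fiber_of_neg_one hG hC htot ha had hh hψa (hψh h hh))
    (c := C.ncard + 2 ^ e) (k := e + 1)
    (fun χ hχ => by
      obtain ⟨z, hz⟩ := h2 χ (by rw [hχ a had, hψa])
      exact ⟨z, by rw [hz, charSum_zero]; push_cast; rfl⟩) (h := h) hh
  have hB := fun h hh => hN.dvd_of_charSum_congr hG hm (C := C) (ψ := 0)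
    (fun h hh => hN.sum_fiber_of_eq_zmultiples hG hC htot ha had hh hall)
    (c := C.ncard) (k := e + 1)
    (fun χ hχ => by
      obtain ⟨z, hz⟩ := h1 χ (by rw [hχ a had]; rfl)
      exact ⟨z, by rw [hz, charSum_zero]; push_cast; rfl⟩) (h := h) hh
  have hA0 := hA 0 (smul_zero _)
  have hB0 := hB 0 (smul_zero _)
  simp only [↓reduceIte, add_zero] at hA0 hB0
  -- Subtraction cancels the unknown `|C|` and leaves twice the indicator at `a` plus `2 ^ e`.
  have hsub := dvd_sub hB0 hA0
  obtain ⟨rfl, hx⟩ := eq_one_of_two_pow_succ_dvd (e := e) (x := C.indicator (1 : G → ℤ) a)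
    (by rcases indicator_one_eq_zero_or_one C a with h | h <;> simp [h])
    (by obtain ⟨y, hy⟩ := hsub; exact ⟨y, by linear_combination hy⟩)
  have haC : a ∈ C := by by_contra haC; simp [haC] at hx
  refine ⟨a, Set.Subset.antisymm (fun g hg => ?_) (by simpa using haC)⟩
  have hgm := hN.nsmul_smul hG g
  have hgp := (mem_zmultiples_of_addOrderOf_two ha).1 (hall _ (hN.nsmul_one_sub_smul hG g))
  have hdec := IsOddProjector.one_sub_smul_add_smul N g
  by_cases hh0 : N • g = 0
  · rw [hh0, add_zero] at hdec
    rw [hdec] at hgp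
    rcases hgp with rfl | rfl
    · exact absurd hg hzero
    · rfl
  -- Now `e = 1`: for nonzero odd part `h`, both the sum and the difference of the two indicators on
  -- `h + ⟨a⟩` are divisible by 4, so both vanish.
  · exfalso
    have hA1 := hA _ hgm
    have hB1 := hB _ hgm
    rw [if_neg hh0] at hA1 hB1
    norm_num at hA1 hB1
    rcases hgp with hp | hp
    · rw [hp, zero_add] at hdec
      rw [hdec] at hA1 hB1
      rcases indicator_one_eq_zero_or_one C (a + g) with h | h <;> simp [h, hg] at hA1 hB1
    · rw [hp] at hdec
      rw [hdec] at hA1 hB1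
      rcases indicator_one_eq_zero_or_one C (N • g) with h | h <;> simp [h, hg] at hA1 hB1

/-- The symmetry of the connection set which, for a Sylow `2`-subgroup of order at least four,
is forced by perfect state transfer. -/
lemma HasPST.coset_symmetry {d m : ℕ} {N : ℤ} (hN : IsOddProjector d m N) (hm : Odd m)
    (hG : Nat.card G = 2 ^ d * m)
    (htot : ∀ p c : G, 2 ^ d • p = 0 → 2 ^ d • c = 0 →
      c ∈ AddSubgroup.zmultiples p ∨ p ∈ AddSubgroup.zmultiples c)
    {C : Set G} (hneg : ∀ g ∈ C, -g ∈ C) (hzero : (0 : G) ∉ C)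
    {b : G} (hb : addOrderOf b = 4) (hbd : 2 ^ d • b = 0)
    (h : HasPST (SimpleGraph.addCayley C)) :
    IsPowerClosed C ∧ Xor (2 • b ∈ C) (b ∈ C) ∧ ∀ h, m • h = 0 → h ≠ 0 →
      ((h ∈ C ↔ b + h ∈ C) ∧ (2 • b + h ∈ C ↔ b + h ∈ C)) := by
  obtain ⟨a, ha0, ha2, hC, e, h1, h2⟩ := h.exists_valuation hneg hzero
  have ha : addOrderOf a = 2 := addOrderOf_eq_prime ha2 ha0
  have h2b := addOrderOf_two_nsmul_of_four hb
  have h2bd : 2 ^ d • 2 • b = 0 := by rw [smul_comm, hbd, smul_zero]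
  have had : 2 ^ d • a = 0 := by
    obtain ⟨k, rfl⟩ : ∃ k, d = k + 1 := by
      refine Nat.exists_eq_succ_of_ne_zero ?_
      rintro rfl
      rw [pow_zero, one_smul] at hbd
      rw [hbd] at hb; simp at hb
    rw [pow_succ, mul_smul, ha2, smul_zero]
  obtain rfl : a = 2 • b := eq_of_addOrderOf_two ha h2b (htot _ _ h2bd had)
  obtain ⟨ψ, hψa, hψh⟩ := exists_char_neg_one hm ha0 ha2
  -- Doubling `ψ` moves the value `-1` from `a = 2 • b` down to `b`; the doubled character is `1` at
  -- `a`, so it falls under the other eigenvalue congruence.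
  have hψb : (2 • ψ) b = -1 := by
    rw [AddChar.nsmul_apply, ← AddChar.map_nsmul_eq_pow, hψa]
  have hA := fun h hh => hN.dvd_of_charSum_congr hG hm (C := C) (ψ := ψ)
    (fun h hh => hN.sum_fiber_of_neg_one hG hC htot ha had hh hψa (hψh h hh))
    (c := C.ncard + 2 ^ e) (k := e + 1)
    (fun χ hχ => by
      obtain ⟨z, hz⟩ := h2 χ (by rw [hχ _ had, hψa])
      exact ⟨z, by rw [hz, charSum_zero]; push_cast; rfl⟩) (h := h) hh
  have hB := fun h hh => hN.dvd_of_charSum_congr hG hm (C := C) (ψ := 2 • ψ)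
    (fun h hh => hN.sum_fiber_of_order_four hG hC htot hb hbd hh hψb
      (by rw [AddChar.nsmul_apply, hψh h hh, one_pow]))
    (c := C.ncard) (k := e + 1)
    (fun χ hχ => by
      obtain ⟨z, hz⟩ := h1 χ (by
        rw [hχ _ had, AddChar.map_nsmul_eq_pow, hψb]; norm_num)
      exact ⟨z, by rw [hz, charSum_zero]; push_cast; rfl⟩) (h := h) hh
  have hA0 := hA 0 (smul_zero _)
  have hB0 := hB 0 (smul_zero _)
  simp only [↓reduceIte, add_zero] at hA0 hB0
  have hsub := dvd_sub hB0 hA0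
  obtain ⟨rfl, hx⟩ := eq_one_of_two_pow_succ_dvd (e := e)
    (x := C.indicator (1 : G → ℤ) (2 • b) - C.indicator (1 : G → ℤ) b)
    (by rcases indicator_one_eq_zero_or_one C b with h | h <;>
        rcases indicator_one_eq_zero_or_one C (2 • b) with h' | h' <;> simp [h, h'])
    (by obtain ⟨y, hy⟩ := hsub; exact ⟨y, by linear_combination hy⟩)
  refine ⟨hC, ?_, fun h hh hh0 => ?_⟩
  · rw [sub_ne_zero, Ne, indicator_one_eq_iff] at hx
    rw [xor_iff_not_iff]
    exact hx
  · have hA1 := hA h hh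
    have hB1 := hB h hh
    rw [if_neg hh0] at hA1 hB1
    norm_num at hA1 hB1
    rw [← indicator_one_eq_iff, ← indicator_one_eq_iff]
    -- Modulo 4 the first congruence equates the bits at `h` and `2 • b + h`; the second then
    -- equates them with the bit at `b + h`.
    rcases indicator_one_eq_zero_or_one C h with e1 | e1 <;>
      rcases indicator_one_eq_zero_or_one C (b + h) with e2 | e2 <;>
      rcases indicator_one_eq_zero_or_one C (2 • b + h) with e3 | e3 <;>
      rw [e1, e3] at hA1 <;> rw [e1, e2, e3] at hB1 <;> rw [e1, e2, e3] <;> omega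

end

/-! ### Sufficiency: coset symmetry gives transfer at time `π/2`. -/

section
variable {G : Type*} [AddCommGroup G] [Fintype G]

lemma charSum_sdiff_add_inter (C K : Set G) (χ : AddChar G ℂ) :
    charSum C χ = charSum (C \ K) χ + charSum (C ∩ K) χ := by
  classical
  rw [charSum, charSum, charSum, ← Finset.sum_add_distrib]
  refine Finset.sum_congr rfl fun g _ => ?_
  by_cases h1 : g ∈ C <;> by_cases h2 : g ∈ K <;> simp [h1, h2]

lemma charSum_pair {x y : G} (hxy : x ≠ y) (χ : AddChar G ℂ) :
    charSum {x, y} χ = χ x + χ y := by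
  classical
  have : ∀ g, ({x, y} : Set G).indicator χ g = if g ∈ ({x, y} : Finset G) then χ g else 0 := by
    intro g
    simp [Set.indicator_apply]
  rw [charSum]
  simp_rw [this]
  rw [Finset.sum_ite_mem, Finset.univ_inter, Finset.sum_pair hxy]

lemma hasPST_of_coset_symmetry [DecidableEq G] {d m : ℕ} {N : ℤ} (hN : IsOddProjector d m N)
    (hG : Nat.card G = 2 ^ d * m)
    (htot : ∀ p c : G, 2 ^ d • p = 0 → 2 ^ d • c = 0 →
      c ∈ AddSubgroup.zmultiples p ∨ p ∈ AddSubgroup.zmultiples c)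
    {C : Set G} (hneg : ∀ g ∈ C, -g ∈ C) (hzero : (0 : G) ∉ C)
    {b : G} (hb : addOrderOf b = 4) (hbd : 2 ^ d • b = 0) (hC : IsPowerClosed C)
    (hxor : Xor (2 • b ∈ C) (b ∈ C))
    (hsym : ∀ h, m • h = 0 → h ≠ 0 →
      ((h ∈ C ↔ b + h ∈ C) ∧ (2 • b + h ∈ C ↔ b + h ∈ C))) :
    HasPST (SimpleGraph.addCayley C) := by
  have h2b := addOrderOf_two_nsmul_of_four hb
  have h2b0 : 2 • b ≠ 0 := by intro h; rw [h] at h2b; simp at h2b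
  have h22 : 2 • 2 • b = 0 := 
    addOrderOf_dvd_iff_nsmul_eq_zero.1 h2b.dvd
  have hbn := ne_neg_of_addOrderOf_four hb
  have hb0 : b ≠ 0 := by rintro rfl; simp at hb
  have h2bb : 2 • b ≠ b := by intro h; rw [h, hb] at h2b; norm_num at h2b
  have h2bn : 2 • b ≠ -b := by intro h; rw [h, addOrderOf_neg, hb] at h2b; norm_num at h2b
  set K := AddSubgroup.zmultiples b with hK
  have hbK : b ∈ K := AddSubgroup.mem_zmultiples b
  have hE : ∀ g, g + b ∈ C \ (K : Set G) ↔ g ∈ C \ (K : Set G) := by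
    intro g
    simp only [Set.mem_sdiff, SetLike.mem_coe, AddSubgroup.add_mem_cancel_right K hbK]
    refine and_congr_left fun hgK => ?_
    -- If the 2-part of `g` lies in `K`, the odd part is nonzero and the coset symmetry applies;
    -- outside `K`, power-closedness alone suffices.
    by_cases hp : (1 - N) • g ∈ K
    · have hdec := IsOddProjector.one_sub_smul_add_smul N g
      have hm := hN.nsmul_smul hG g
      have h0 : N • g ≠ 0 := by
        intro h0
        rw [h0, add_zero] at hdec
        rw [hdec] at hp
        exact hgK hp
      obtain ⟨e1, e2⟩ := hsym _ hm h0
      have e3 := hN.mem_iff hG hC hbd hm (s := -1) (r := 1) (by decide) isCoprime_one_left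
      rw [neg_smul, one_smul, one_smul] at e3
      have hgb : g + b = ((1 - N) • g + b) + N • g := by
        conv_lhs => rw [← hdec]
        abel
      rw [hgb]
      conv_rhs => rw [← hdec]
      rw [mem_zmultiples_of_addOrderOf_four hb] at hp
      rcases hp with hp | hp | hp | hp <;> rw [hp]
      · rw [zero_add, zero_add, e1]
      · have : 2 • b + b = -b := by
          rw [eq_neg_iff_add_eq_zero, ← h22]; abel
        rw [this, e2, e3]
      · rw [← two_nsmul, e2]
      · rw [neg_add_cancel, zero_add, e1, e3]
    · exact hN.add_mem_iff hG hC htot hbd hp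
  have hint := fun χ => hC.charSum_int χ
  choose z hz using hint
  choose x hx hxe using fun χ => exists_isIntegral_charSum_eq_mul hE χ
  -- Modulo 4 only `C ∩ K` matters, since the invariant set `C \ K` contributes 4 times an algebraic
  -- integer.
  have hkey : ∀ (χ : AddChar G ℂ) (κ : ℤ),
      charSum (C ∩ K) χ - charSum (C ∩ K) 0 = κ → (4 : ℤ) ∣ z χ - z 0 - κ := by
    intro χ κ hκ
    refine Int.dvd_of_mul_isIntegral ((hx χ).sub (hx 0)) ?_
    push_cast
    rw [← hκ, ← hz, ← hz, charSum_sdiff_add_inter C K χ, charSum_sdiff_add_inter C K 0, hxe, hxe,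
      hb]
    push_cast
    ring
  have hneg' : -b ∈ C ↔ b ∈ C := ⟨fun h => by simpa using hneg _ h, hneg b⟩
  have hval : ∀ χ : AddChar G ℂ,
      (χ (2 • b) = 1 → ∃ κ : ℤ, charSum (C ∩ K) χ - charSum (C ∩ K) 0 = κ ∧ (4 : ℤ) ∣ κ) ∧
      (χ (2 • b) = -1 → charSum (C ∩ K) χ - charSum (C ∩ K) 0 = (-2 : ℤ)) := by
    intro χ
    rcases hxor with ⟨h1, h2⟩ | ⟨h1, h2⟩
    · have : C ∩ K = {2 • b} := by
        ext g
        simp only [Set.mem_inter_iff, SetLike.mem_coe, hK, mem_zmultiples_of_addOrderOf_four hb,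
          Set.mem_singleton_iff]
        constructor
        · rintro ⟨hg, rfl | rfl | rfl | rfl⟩
          exacts [absurd hg hzero, rfl, absurd hg h2, absurd (hneg'.1 hg) h2]
        · rintro rfl
          exact ⟨h1, by tauto⟩
      rw [this, charSum_singleton, charSum_singleton]
      refine ⟨fun h => ⟨0, by rw [h]; simp, dvd_zero _⟩, fun h => ?_⟩
      rw [h]; simp; norm_num
    · have : C ∩ K = {b, -b} := by
        ext g
        simp only [Set.mem_inter_iff, SetLike.mem_coe, hK, mem_zmultiples_of_addOrderOf_four hb,
          Set.mem_singleton_iff, Set.mem_insert_iff]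
        constructor
        · rintro ⟨hg, rfl | rfl | rfl | rfl⟩
          exacts [absurd hg hzero, absurd hg h2, Or.inl rfl, Or.inr rfl]
        · rintro (rfl | rfl)
          exacts [⟨h1, by tauto⟩, ⟨hneg'.2 h1, by tauto⟩]
      rw [this, charSum_pair hbn, charSum_pair hbn, AddChar.map_neg_eq_inv,
        AddChar.map_nsmul_eq_pow]
      refine ⟨fun h => ?_, fun h => ?_⟩
      · rcases sq_eq_one_iff.1 h with h | h
        · exact ⟨0, by rw [h]; norm_num, dvd_zero _⟩
        · exact ⟨-4, by rw [h]; norm_num, by norm_num⟩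
      -- Here `χ b` is `i` or `-i`, so the pair contributes `0`, against `2` for the trivial
      -- character.
      · have h0 := (χ.val_isUnit b).ne_zero
        have : χ b + (χ b)⁻¹ = 0 := by
          field_simp
          rw [h]; ring
        rw [this]; norm_num
  refine hasPST_of_mod_four hneg hzero h2b0 h22 (fun χ hχ => ?_) (fun χ hχ => ?_)
  · obtain ⟨κ, hκ, hd⟩ := (hval χ).1 hχ
    obtain ⟨w, hw⟩ := hkey χ κ hκ
    obtain ⟨y, hy⟩ := hd
    refine ⟨w + y, ?_⟩
    rw [hz, hz]
    have : z χ = z 0 + 4 * (w + y) := by linarith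
    exact_mod_cast this
  · obtain ⟨w, hw⟩ := hkey χ _ ((hval χ).2 hχ)
    refine ⟨w - 1, ?_⟩
    rw [hz, hz]
    have : z χ = z 0 + 2 + 4 * (w - 1) := by linarith
    exact_mod_cast this

end

/-! ### The set equations (c) and (d) as coset symmetry. -/

section
variable {G : Type*} [AddCommGroup G]

lemma Nat.two_pow_mul_odd_left_inj {j k s r : ℕ} (hs : Odd s) (hr : Odd r)
    (h : 2 ^ j * s = 2 ^ k * r) : j = k := by
  have key : ∀ {j k s r : ℕ}, Odd r → 2 ^ j * s = 2 ^ k * r → j ≤ k := by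
    intro j k s r hr h
    have h1 : 2 ^ j ∣ 2 ^ k * r := ⟨s, h.symm⟩
    exact (Nat.pow_dvd_pow_iff_le_right (by norm_num)).1
      ((Nat.Coprime.pow_left j (Nat.coprime_two_left.2 hr)).dvd_of_dvd_mul_right h1)
  exact le_antisymm (key hr h) (key hs h.symm)

lemma exists_odd_addOrderOf_eq_iff {d m k : ℕ} (hm : Odd m) {p h : G} (hp : 2 ^ d • p = 0)
    (hh : m • h = 0) :
    (∃ r, Odd r ∧ addOrderOf (p + h) = 2 ^ k * r) ↔ addOrderOf p = 2 ^ k := by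
  have h1 := addOrderOf_dvd_of_nsmul_eq_zero hp
  have h2 := addOrderOf_dvd_of_nsmul_eq_zero hh
  have hodd : Odd (addOrderOf h) := hm.of_dvd_nat h2
  have hcop : (addOrderOf p).Coprime (addOrderOf h) :=
    Nat.Coprime.coprime_dvd_left h1 (Nat.Coprime.pow_left d (Nat.coprime_two_left.2 hodd))
  rw [(AddCommute.all p h).addOrderOf_add_eq_mul_addOrderOf_of_coprime hcop]
  constructor
  · rintro ⟨r, hr, he⟩
    obtain ⟨j, -, hj⟩ := (Nat.dvd_prime_pow Nat.prime_two).1 h1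
    rw [hj] at he ⊢
    rw [Nat.two_pow_mul_odd_left_inj hodd hr he]
  · intro he
    exact ⟨_, hodd, by rw [he]⟩

variable [Fintype G]

/-- In the presence of power-closedness, the two set equations relating the parts of the
connection set say that nontrivial cosets of the subgroup of order four, based at elements of odd
order, are contained in or disjoint from it. -/
lemma twoPart_eq_iff_coset_symmetry {d m : ℕ} {N : ℤ} (hN : IsOddProjector d m N) (hm : Odd m)
    (hG : Nat.card G = 2 ^ d * m)
    (htot : ∀ p c : G, 2 ^ d • p = 0 → 2 ^ d • c = 0 →
      c ∈ AddSubgroup.zmultiples p ∨ p ∈ AddSubgroup.zmultiples c)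
    {C : Set G} (hzero : (0 : G) ∉ C)
    {b : G} (hb : addOrderOf b = 4) (hbd : 2 ^ d • b = 0) (hC : IsPowerClosed C) :
    (twoPart C 0 = multiples 4 (twoPart C 2 \ {b, -b}) ∧
      twoPart C 1 \ {2 • b} = multiples 2 (twoPart C 2 \ {b, -b})) ↔
    ∀ h, m • h = 0 → h ≠ 0 →
      ((h ∈ C ↔ b + h ∈ C) ∧ (2 • b + h ∈ C ↔ b + h ∈ C)) := by
  have h2b := addOrderOf_two_nsmul_of_four hb
  have h4b : 4 • b = 0 := by rw [← hb, addOrderOf_nsmul_eq_zero]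
  have h2bd : 2 ^ d • 2 • b = 0 := by rw [smul_comm, hbd, smul_zero]
  have hT : ∀ (k : ℕ) (p h : G), 2 ^ d • p = 0 → m • h = 0 →
      (p + h ∈ twoPart C k ↔ p + h ∈ C ∧ addOrderOf p = 2 ^ k) := fun k p h hp hh =>
    and_congr_right fun _ => exists_odd_addOrderOf_eq_iff hm hp hh
  have hsplit : ∀ g : G, ∃ p h, 2 ^ d • p = 0 ∧ m • h = 0 ∧ g = p + h := fun g =>
    ⟨_, _, hN.nsmul_one_sub_smul hG g, hN.nsmul_smul hG g,
      (IsOddProjector.one_sub_smul_add_smul N g).symm⟩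
  have hneg : ∀ h, m • h = 0 → (-b + h ∈ C ↔ b + h ∈ C) := fun h hh => by
    simpa using hN.mem_iff hG hC hbd hh (s := -1) (r := 1) (by decide) isCoprime_one_left
  -- The 2-part of an element of `C_2` is `b` or `-b`; removing `b` and `-b` themselves amounts to
  -- requiring a nonzero odd part `h`.
  have hT2 : ∀ x, x ∈ twoPart C 2 \ {b, -b} ↔
      ∃ h, m • h = 0 ∧ h ≠ 0 ∧ b + h ∈ C ∧ (x = b + h ∨ x = -b + h) := by
    intro x
    constructor
    · rintro ⟨hx, hxb⟩
      obtain ⟨p, h, hp, hh, rfl⟩ := hsplit x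
      rw [hT 2 p h hp hh] at hx
      simp only [Set.mem_insert_iff, Set.mem_singleton_iff, not_or] at hxb
      rcases eq_or_eq_neg_of_addOrderOf_four hb hx.2 (htot p b hp hbd) with rfl | rfl
      · exact ⟨h, hh, fun h0 => hxb.1 (by simp [h0]), hx.1, Or.inl rfl⟩
      · exact ⟨h, hh, fun h0 => hxb.2 (by simp [h0]), (hneg h hh).1 hx.1, Or.inr rfl⟩
    · rintro ⟨h, hh, h0, hbh, hx⟩
      have key : ∀ q q' : G, 2 ^ d • q = 0 → 2 ^ d • q' = 0 → q + h ≠ q' := by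
        intro q q' hq hq' he
        have := congrArg (N • ·) he
        simp only [smul_add, hN.smul_eq_zero hq, hN.smul_eq_zero hq', hN.smul_eq_self hh,
          zero_add] at this
        exact h0 this
      have hbd' : 2 ^ d • -b = 0 := by rw [smul_neg, hbd, neg_zero]
      rcases hx with rfl | rfl
      · exact ⟨(hT 2 b h hbd hh).2 ⟨hbh, hb⟩, by
          simp only [Set.mem_insert_iff, Set.mem_singleton_iff, not_or]
          exact ⟨key _ _ hbd hbd, key _ _ hbd hbd'⟩⟩
      · exact ⟨(hT 2 (-b) h hbd' hh).2 ⟨(hneg h hh).2 hbh, by rw [addOrderOf_neg]; exact hb⟩, by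
          simp only [Set.mem_insert_iff, Set.mem_singleton_iff, not_or]
          exact ⟨key _ _ hbd' hbd, key _ _ hbd' hbd'⟩⟩
  have hscale : ∀ r : ℕ, IsCoprime (r : ℤ) (m : ℤ) → ∀ h, m • h = 0 →
      (b + r • h ∈ C ↔ b + h ∈ C) := fun r hr h hh => by
    simpa using hN.mem_iff hG hC hbd hh (s := 1) (r := r) (by decide) hr
  have hdiv : ∀ r : ℕ, IsCoprime (r : ℤ) (m : ℤ) → ∀ h : G, m • h = 0 →
      ∃ h', m • h' = 0 ∧ r • h' = h := fun r hr h hh => by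
    obtain ⟨u, v, huv⟩ := hr
    refine ⟨u • h, by rw [smul_comm, hh, smul_zero], ?_⟩
    have : ((r : ℤ) * u + v * m) • h = h := by
      rw [mul_comm (r : ℤ), huv, one_smul]
    rwa [add_smul, mul_smul, mul_smul, natCast_zsmul, natCast_zsmul, hh, smul_zero,
      add_zero] at this
  have hinj : ∀ r : ℕ, IsCoprime (r : ℤ) (m : ℤ) → ∀ h : G, m • h = 0 → r • h = 0 → h = 0 :=
    fun r hr h hh h0 => by
      obtain ⟨u, v, huv⟩ := hr
      rw [← one_smul ℤ h, ← huv, add_smul, mul_smul, mul_smul, natCast_zsmul, natCast_zsmul, hh,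
        h0, smul_zero, smul_zero, add_zero]
  have c2 : IsCoprime ((2 : ℕ) : ℤ) (m : ℤ) :=
    Nat.isCoprime_iff_coprime.2 (Nat.coprime_two_left.2 hm)
  have c4 : IsCoprime ((4 : ℕ) : ℤ) (m : ℤ) :=
    Nat.isCoprime_iff_coprime.2 (Nat.Coprime.pow_left 2 (Nat.coprime_two_left.2 hm))
  -- For `r` equal to 2 or 4, multiplication by `r` merges the two signs of `b` and permutes the odd
  -- part, without affecting whether `b + h` lies in `C`.
  have hmul : ∀ r : ℕ, IsCoprime (r : ℤ) (m : ℤ) → r • b = r • -b → ∀ x,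
      (x ∈ multiples r (twoPart C 2 \ {b, -b}) ↔
        ∃ h, m • h = 0 ∧ h ≠ 0 ∧ b + h ∈ C ∧ x = r • b + h) := by
    intro r hr hrb x
    constructor
    · rintro ⟨y, hy, rfl⟩
      obtain ⟨h, hh, h0, hbh, hy⟩ := (hT2 y).1 hy
      refine ⟨r • h, by rw [smul_comm, hh, smul_zero], fun h' => h0 (hinj r hr h hh h'),
        (hscale r hr h hh).2 hbh, ?_⟩
      rcases hy with rfl | rfl
      · rw [smul_add]
      · rw [smul_add, hrb]
    · rintro ⟨h, hh, h0, hbh, rfl⟩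
      obtain ⟨h', hh', rfl⟩ := hdiv r hr h hh
      refine ⟨b + h', (hT2 _).2 ⟨h', hh', ?_, (hscale r hr h' hh').1 hbh, Or.inl rfl⟩, smul_add ..⟩
      rintro rfl
      exact h0 (smul_zero _)
  have hmul4 := hmul 4 c4 (by rw [smul_neg, h4b, neg_zero])
  have hmul2 := hmul 2 c2 (by
    rw [smul_neg, eq_neg_iff_add_eq_zero, ← add_smul, h4b])
  -- The vanishing term `4 • b` is kept so that both sides of (c) are parametrised by the same base
  -- point.
  have hT0 : ∀ x, x ∈ twoPart C 0 ↔ ∃ h, m • h = 0 ∧ h ≠ 0 ∧ h ∈ C ∧ x = 4 • b + h := by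
    intro x
    rw [h4b]
    constructor
    · intro hx
      obtain ⟨p, h, hp, hh, rfl⟩ := hsplit x
      rw [hT 0 p h hp hh, pow_zero, AddMonoid.addOrderOf_eq_one_iff] at hx
      obtain ⟨hx, rfl⟩ := hx
      rw [zero_add] at hx
      exact ⟨h, hh, fun h0 => hzero (h0 ▸ hx), hx, rfl⟩
    · rintro ⟨h, hh, -, hx, rfl⟩
      rw [hT 0 0 h (smul_zero _) hh]
      simpa using hx
  have hT1 : ∀ x, x ∈ twoPart C 1 \ {2 • b} ↔
      ∃ h, m • h = 0 ∧ h ≠ 0 ∧ 2 • b + h ∈ C ∧ x = 2 • b + h := by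
    intro x
    constructor
    · rintro ⟨hx, hxb⟩
      obtain ⟨p, h, hp, hh, rfl⟩ := hsplit x
      rw [hT 1 p h hp hh, pow_one] at hx
      obtain rfl : p = 2 • b := eq_of_addOrderOf_two hx.2 h2b (htot _ _ h2bd hp)
      exact ⟨h, hh, fun h0 => hxb (by simp [h0]), hx.1, rfl⟩
    · rintro ⟨h, hh, h0, hx, rfl⟩
      exact ⟨(hT 1 _ h h2bd hh).2 ⟨hx, by rw [h2b, pow_one]⟩, by simpa using h0⟩
  have hcongr : ∀ (q : G) (P Q : G → Prop) (S T : Set G),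
      (∀ x, x ∈ S ↔ ∃ h, m • h = 0 ∧ h ≠ 0 ∧ P h ∧ x = q + h) →
      (∀ x, x ∈ T ↔ ∃ h, m • h = 0 ∧ h ≠ 0 ∧ Q h ∧ x = q + h) →
      (S = T ↔ ∀ h, m • h = 0 → h ≠ 0 → (P h ↔ Q h)) := by
    intro q P Q S T hS hT
    have aux : ∀ (R : G → Prop) (U : Set G),
        (∀ x, x ∈ U ↔ ∃ h, m • h = 0 ∧ h ≠ 0 ∧ R h ∧ x = q + h) →
        ∀ h, m • h = 0 → h ≠ 0 → (q + h ∈ U ↔ R h) := by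
      intro R U hU h hh h0
      rw [hU]
      constructor
      · rintro ⟨h', -, -, hR, he⟩
        rwa [add_left_cancel he]
      · intro hR
        exact ⟨h, hh, h0, hR, rfl⟩
    constructor
    · rintro rfl h hh h0
      rw [← aux P S hS h hh h0, aux Q S hT h hh h0]
    · intro H
      ext x
      rw [hS, hT]
      exact exists_congr fun h => and_congr_right fun hh => and_congr_right fun h0 =>
        and_congr_left fun _ => H h hh h0
  rw [hcongr _ _ _ _ _ hT0 hmul4, hcongr _ _ _ _ _ hT1 hmul2]
  exact ⟨fun H h hh h0 => ⟨H.1 h hh h0, H.2 h hh h0⟩,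
    fun H => ⟨fun h hh h0 => (H h hh h0).1, fun h hh h0 => (H h hh h0).2⟩⟩

end

/-! ### The three cases of the theorem. -/

theorem theorem8p1 {G : Type*} [AddCommGroup G] [Fintype G] [DecidableEq G]
    (d m : ℕ) (hm : Odd m) (hG : Nat.card G = 2 ^ d * m)
    (hSylow : ∀ P : Sylow 2 (Multiplicative G), IsCyclic P)
    (C : Set G) (hneg : ∀ g ∈ C, -g ∈ C) (hzero : (0 : G) ∉ C) :
    (d = 0 → ¬ HasPST (SimpleGraph.addCayley C)) ∧
    (d = 1 → (HasPST (SimpleGraph.addCayley C) ↔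
      (⊤ : (SimpleGraph.addCayley C).Subgraph).IsPerfectMatching)) ∧
    (2 ≤ d →
      (∃! a : G, addOrderOf a = 2) ∧
      (∃ b : G, b ≠ -b ∧ {g : G | addOrderOf g = 4} = {b, -b}) ∧
      ∀ a b : G, addOrderOf a = 2 → addOrderOf b = 4 →
        (HasPST (SimpleGraph.addCayley C) ↔
          IsPowerClosed C ∧
          Xor (a ∈ C) (b ∈ C) ∧
          twoPart C 0 = multiples 4 (twoPart C 2 \ {b, -b}) ∧
          twoPart C 1 \ {a} = multiples 2 (twoPart C 2 \ {b, -b}))) := by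
  obtain ⟨x, hxo, hx⟩ := exists_generator_two_primary hm hG hSylow
  have hxd : 2 ^ d • x = 0 := by rw [← hxo, addOrderOf_nsmul_eq_zero]
  have htot : ∀ p c : G, 2 ^ d • p = 0 → 2 ^ d • c = 0 →
      c ∈ AddSubgroup.zmultiples p ∨ p ∈ AddSubgroup.zmultiples c :=
    fun p c hp hc => mem_zmultiples_total hx hp hc hxd
  refine ⟨?_, ?_, fun hd => ?_⟩
  · rintro rfl
    exact not_hasPST_of_odd_card (by rwa [hG, pow_zero, one_mul]) hneg hzero
  · rintro rfl
    rw [isPerfectMatching_addCayley_iff hneg hzero]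
    refine ⟨eq_singleton_of_hasPST hm hG htot hneg hzero, ?_⟩
    rintro ⟨c, rfl⟩
    exact hasPST_of_eq_singleton hneg hzero
  · obtain ⟨k, rfl⟩ := Nat.exists_eq_add_of_le' hd
    have hkill : ∀ g : G, addOrderOf g ∣ 4 → 2 ^ (k + 2) • g = 0 := fun g hg =>
      addOrderOf_dvd_iff_nsmul_eq_zero.1 (hg.trans ⟨2 ^ k, by ring⟩)
    have huniq2 : ∀ a a' : G, addOrderOf a = 2 → addOrderOf a' = 2 → a = a' := fun a a' ha ha' =>
      eq_of_addOrderOf_two ha ha' (htot _ _ (hkill _ (by rw [ha']; norm_num))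
        (hkill _ (by rw [ha]; norm_num)))
    have huniq4 : ∀ b g : G, addOrderOf b = 4 → addOrderOf g = 4 → g = b ∨ g = -b :=
      fun b g hb hg => eq_or_eq_neg_of_addOrderOf_four hb hg
        (htot _ _ (hkill _ (by rw [hg])) (hkill _ (by rw [hb])))
    obtain ⟨b₀, hb₀⟩ : ∃ b : G, addOrderOf b = 4 := by
      -- The generator `x` has order `2 ^ (k + 2)`, so this multiple has order 4.
      refine ⟨2 ^ k • x, ?_⟩
      have hpow : (2 : ℕ) ^ (k + 2) = 2 ^ k * 4 := by ring
      rw [addOrderOf_nsmul' x (by positivity), hxo, hpow,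
        Nat.gcd_eq_right (Nat.dvd_mul_right _ _), Nat.mul_div_cancel_left _ (by positivity)]
    refine ⟨⟨2 • b₀, addOrderOf_two_nsmul_of_four hb₀, fun a ha =>
      huniq2 _ _ ha (addOrderOf_two_nsmul_of_four hb₀)⟩,
      ⟨b₀, ne_neg_of_addOrderOf_four hb₀, ?_⟩, fun a b ha hb => ?_⟩
    · ext g
      simp only [Set.mem_ofPred_eq, Set.mem_insert_iff, Set.mem_singleton_iff]
      refine ⟨huniq4 b₀ g hb₀, ?_⟩
      rintro (rfl | rfl)
      exacts [hb₀, by rw [addOrderOf_neg, hb₀]]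
    · obtain ⟨N, hN⟩ := exists_isOddProjector (k + 2) hm
      obtain rfl := huniq2 _ _ ha (addOrderOf_two_nsmul_of_four hb)
      have hbd := hkill b (by rw [hb])
      constructor
      · intro h
        obtain ⟨hC, hxor, hsym⟩ := h.coset_symmetry hN hm hG htot hneg hzero hb hbd
        exact ⟨hC, hxor, (twoPart_eq_iff_coset_symmetry hN hm hG htot hzero hb hbd hC).2 hsym⟩
      · rintro ⟨hC, hxor, h⟩
        exact hasPST_of_coset_symmetry hN hG htot hneg hzero hb hbd hC hxor
          ((twoPart_eq_iff_coset_symmetry hN hm hG htot hzero hb hbd hC).1 h)
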